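/- Let $(Z_i^{(1)})_{i\ge1}$ and $(Z_i^{(2)})_{i\ge1}$ be two sequences of random vectors in $\mathbb{R}^2$ on a common probability space, each i.i.d., the two sequences being independent of each other (their step distributions may differ), with $\mathbb{E}\|Z_1^{(k)}\|^2<\infty$ for $k=1,2$. Put $S_0^{(k)}=0$, $S_n^{(k)}=\sum_{i=1}^n Z_i^{(k)}$, $\mu^{(k)}=\mathbb{E}[Z_1^{(k)}]$, and let $$D_n=\operatorname{diam}\bigl(\operatorname{chull}\{S_j^{(k)}: 0\le j\le n,\ k=1,2\}\bigr).$$ Assume (A1) $0\notin\{\mu^{(1)},\mu^{(2)},\mu^{(1)}-\mu^{(2)}\}$; (A2) the maximum of the three numbers $\|\mu^{(1)}\|$, $\|\mu^{(2)}\|$, $\|\mu^{(1)}-\mu^{(2)}\|$ (Euclidean norm) is attained by exactly one of them. For $v\ne0$ let $e(v)=v/\|v\|$, and define $$\sigma_D^2=\begin{cases}\mathbb{E}\bigl[((Z_1^{(1)}-\mu^{(1)})\cdot e(\mu^{(1)}))^2\bigr] & \text{if } \|\mu^{(1)}\| \text{ is the maximum},\\ \mathbb{E}\bigl[((Z_1^{(2)}-\mu^{(2)})\cdot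 e(\mu^{(2)}))^2\bigr] & \text{if } \|\mu^{(2)}\| \text{ is the maximum},\\ \mathbb{E}\bigl[(((Z_1^{(1)}-\mu^{(1)})-(Z_1^{(2)}-\mu^{(2)}))\cdot e(\mu^{(1)}-\mu^{(2)}))^2\bigr] & \text{if } \|\mu^{(1)}-\mu^{(2)}\| \text{ is the maximum}.\end{cases}$$ Assume $\sigma_D^2>0$. Then $\mathbb{E}[D_n^2]<\infty$ for every $n \ge 0$, and for every $x\in\mathbb{R}$, $$\lim_{n\to\infty}\mathbb{P}\left[\frac{D_n-\mathbb{E}[D_n]}{\sqrt{\operatorname{Var}[D_n]}}\le x\right]=\lim_{n\to\infty}\mathbb{P}\left[\frac{D_n-\mathbb{E}[D_n]}{\sqrt{\sigma_D^2\,n}}\le x\right]=\Phi(x),$$ where $\Phi$ is the cumulative distribution function of the standard normal distribution. -/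

import Mathlib

open MeasureTheory ProbabilityTheory Filter Topology

namespace TwoWalks

/-- The Euclidean plane. -/
abbrev Plane : Type := EuclideanSpace ℝ (Fin 2)

noncomputable section

/-- The walk with the given steps: `S_0 = 0` and `S_n` is the sum of the first `n` steps
(the steps are indexed from `0`, so `step 0` is the first one). -/
def walk {Ω : Type*} (step : ℕ → Ω → Plane) (n : ℕ) (ω : Ω) : Plane :=
  ∑ i ∈ Finset.range n, step i ω

/-- The diameter `D_n` of the convex hull of the first `n` steps of both walks
(the two walks are indexed by `k : Fin 2`). -/
def diameter {Ω : Type*} (Z : Fin 2 → ℕ → Ω → Plane) (n : ℕ) (ω : Ω) : ℝ :=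
  Metric.diam (convexHull ℝ {x : Plane | ∃ k : Fin 2, ∃ j : ℕ, j ≤ n ∧ x = walk (Z k) j ω})

/-- The drift vector of the `k`-th walk: the expectation of its first step. -/
def drift {Ω : Type*} [MeasurableSpace Ω] (P : Measure Ω) (Z : Fin 2 → ℕ → Ω → Plane)
    (k : Fin 2) : Plane :=
  ∫ ω, Z k 0 ω ∂P

/-- The unit vector in the direction of `v ≠ 0`. -/
def dir (v : Plane) : Plane := ‖v‖⁻¹ • v

/-- The three sides of the triangle with vertices `0`, `m 0`, `m 1`, as vectors. -/
def side (m : Fin 2 → Plane) : Fin 3 → Plane := ![m 0, m 1, m 0 - m 1]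

/-- None of the two vectors and their difference vanishes. -/
def NonzeroSides (m : Fin 2 → Plane) : Prop :=
  (0 : Plane) ∉ ({m 0, m 1, m 0 - m 1} : Set Plane)

/-- Exactly one of the three numbers `‖m 0‖`, `‖m 1‖`, `‖m 0 - m 1‖` is maximal,
that is, the maximum is attained by exactly one of the three sides. -/
def UniqueLongestSide (m : Fin 2 → Plane) : Prop :=
  ∃! i : Fin 3, ∀ j : Fin 3, ‖side m j‖ ≤ ‖side m i‖

open Classical in
/-- The limiting variance `σ_D²` of the diameter: the variance of the first step of the first walk,
of the second walk, or of the difference of the two walks, projected on the direction of its drift,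
according to which of the three drifts is the longest. -/
def sigmaDSq {Ω : Type*} [MeasurableSpace Ω] (P : Measure Ω) (Z : Fin 2 → ℕ → Ω → Plane) : ℝ :=
  let m := drift P Z
  if ‖m 1‖ < ‖m 0‖ ∧ ‖m 0 - m 1‖ < ‖m 0‖ then
    ∫ ω, (inner ℝ (Z 0 0 ω - m 0) (dir (m 0))) ^ 2 ∂P
  else if ‖m 0‖ < ‖m 1‖ ∧ ‖m 0 - m 1‖ < ‖m 1‖ then
    ∫ ω, (inner ℝ (Z 1 0 ω - m 1) (dir (m 1))) ^ 2 ∂P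
  else
    ∫ ω, (inner ℝ ((Z 0 0 ω - m 0) - (Z 1 0 ω - m 1)) (dir (m 0 - m 1))) ^ 2 ∂P

end

end TwoWalks

/-! Let `v` be the longest side of the triangle with vertices `0`, `m 0`, `m 1`, oriented from a
vertex `B` to a vertex `A`. On the scale `n` the two paths follow the sides issuing from `0`, and
the diameter of that figure is reached only at the two ends of `n v`. Hence `D_n` should be close to
the difference of the matching end points projected on the direction of `v`, a sum of i.i.d.
variables of variance `σ_D²`. The heart of the proof is that the error `R_n` (`remainder`) satisfies
`E[R_n²] = o(n)`: this is `LongestSide.tendsto_integral_remainder_sq_div`. The classical central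
limit theorem then transfers to `D_n` by Chebyshev and Slutsky (`tendsto_measureReal_div_le`), and
`Var[D_n] / n → σ_D²` by Cauchy–Schwarz (`tendsto_variance_div`).

The upper bound on `R_n` is pathwise (`LongestSide.norm_sub_le_inner_add`). Let `M` bound the
fluctuations of the walks around their means up to time `n`, and `I` those within a window of length
`δ n` at either end. Two walk points whose times are not near the right ends lose a multiple of `n`
in mean distance, so they can win only if `M` exceeds some `ρ n`. For points near the ends,
linearising the norm at `n v` costs `2 I + 2 ε M`. All other configurations are paid for by the
excess of `M` over `ρ n`.

Doob's inequality makes `E[I²]` of order `δ n` and `ε² E[M²]` of order `ε² n`, with `δ ≤ ε²`.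
Applied to the convex function `excess`, it reduces the last term to the uniform integrability of
the squared normalised sums (`tendsto_integral_excess_sq_div`), so second moments suffice. -/

namespace TwoWalks

/-! ### Excess over a level and the pathwise Doob inequality -/

/-- The excess of `|y|` over the level `a`. -/
noncomputable def excess (a y : ℝ) : ℝ := max (|y| - a) 0

lemma excess_nonneg (a y : ℝ) : 0 ≤ excess a y := le_max_right _ _

lemma excess_le_abs {a : ℝ} (ha : 0 ≤ a) (y : ℝ) : excess a y ≤ |y| :=
  max_le (by linarith) (abs_nonneg y)

lemma continuous_excess (a : ℝ) : Continuous (excess a) := by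
  unfold excess; fun_prop

/-- A subgradient of `excess a`. -/
noncomputable def excessSlope (a y : ℝ) : ℝ := if a < y then 1 else if y < -a then -1 else 0

lemma measurable_excessSlope (a : ℝ) : Measurable (excessSlope a) :=
  Measurable.ite measurableSet_Ioi measurable_const
    (Measurable.ite measurableSet_Iio measurable_const measurable_const)

lemma abs_excessSlope_le (a y : ℝ) : |excessSlope a y| ≤ 1 := by
  unfold excessSlope; split_ifs <;> simp

lemma excessSlope_mul_le {a : ℝ} (ha : 0 ≤ a) (y h : ℝ) :
    excessSlope a y * h ≤ excess a (y + h) - excess a y := by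
  unfold excessSlope excess
  have hl := le_max_left (|y + h| - a) 0
  have hr := le_max_right (|y + h| - a) 0
  split_ifs with h1 h2
  · have : max (|y| - a) 0 = y - a := by
      rw [abs_of_pos (ha.trans_lt h1), max_eq_left (by linarith)]
    linarith [le_abs_self (y + h)]
  · have : max (|y| - a) 0 = -y - a := by
      rw [abs_of_neg (by linarith : y < 0), max_eq_left (by linarith)]
    linarith [neg_abs_le (y + h)]
  · have : |y| ≤ a := abs_le.2 ⟨by linarith, by linarith⟩
    rw [max_eq_right (by linarith : |y| - a ≤ 0)]
    linarith

/-- The pathwise form of Doob's maximal inequality in `L²`. -/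
lemma partialSups_sq_le (x : ℕ → ℝ) (n : ℕ) :
    (partialSups x n) ^ 2 ≤
      4 * x n ^ 2 - 4 * ∑ i ∈ Finset.range n, partialSups x i * (x (i + 1) - x i) := by
  -- From `n` to `n + 1` this quantity grows by the square of the jump of the running maximum, and
  -- is unchanged when there is no new maximum.
  have key : 0 ≤ 2 * partialSups x n * x n - (partialSups x n) ^ 2
      - 2 * ∑ i ∈ Finset.range n, partialSups x i * (x (i + 1) - x i) := by
    induction n with
    | zero => simp; nlinarith
    | succ n ih =>
      rw [Finset.sum_range_succ, partialSups_add_one]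
      rcases le_total (x (n + 1)) (partialSups x n) with h | h
      · rw [sup_eq_left.2 h]; linarith
      · rw [sup_eq_right.2 h]; nlinarith [sq_nonneg (x (n + 1) - partialSups x n)]
  nlinarith [sq_nonneg (partialSups x n - 2 * x n)]

/-! ### Doob's inequality for i.i.d. sums and uniform integrability of their squares -/

section

variable {Ω : Type*} [MeasurableSpace Ω] {P : Measure Ω}

lemma measurable_partialSups {f : ℕ → Ω → ℝ} (hf : ∀ n, Measurable (f n)) (n : ℕ) :
    Measurable fun ω => partialSups (fun j => f j ω) n := by
  induction n with
  | zero => simpa using hf 0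
  | succ n ih =>
    simp only [partialSups_add_one]
    exact ih.sup (hf _)

lemma memLp_partialSups {f : ℕ → Ω → ℝ} {p : ENNReal} (hf : ∀ n, MemLp (f n) p P) (n : ℕ) :
    MemLp (fun ω => partialSups (fun j => f j ω) n) p P := by
  induction n with
  | zero => simpa using hf 0
  | succ n ih =>
    simp only [partialSups_add_one]
    exact ih.sup (hf _)

lemma memLp_excess {X : Ω → ℝ} (hX : MemLp X 2 P) {a : ℝ} (ha : 0 ≤ a) :
    MemLp (fun ω => excess a (X ω)) 2 P :=
  hX.mono ((continuous_excess a).comp_aestronglyMeasurable hX.1)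
    (ae_of_all _ fun ω => by
      rw [Real.norm_eq_abs, abs_of_nonneg (excess_nonneg _ _)]
      exact excess_le_abs ha _)

/-- **Doob's maximal inequality** in `L²` for the excess over a level of sums of independent
centred variables. -/
lemma integral_partialSups_excess_sq_le {ξ : ℕ → Ω → ℝ} (hm : ∀ i, Measurable (ξ i))
    (hind : iIndepFun ξ P) (hL : ∀ i, MemLp (ξ i) 2 P) (h0 : ∀ i, ∫ ω, ξ i ω ∂P = 0)
    {a : ℝ} (ha : 0 ≤ a) (n : ℕ) :
    ∫ ω, (partialSups (fun j => excess a (∑ i ∈ Finset.range j, ξ i ω)) n) ^ 2 ∂P ≤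
      4 * ∫ ω, (excess a (∑ i ∈ Finset.range n, ξ i ω)) ^ 2 ∂P := by
  set X : ℕ → Ω → ℝ := fun j ω => ∑ i ∈ Finset.range j, ξ i ω with hX
  have mX : ∀ j, Measurable (X j) := fun j => Finset.measurable_sum _ fun i _ => hm i
  have LX : ∀ j, MemLp (X j) 2 P := fun j => memLp_finsetSum _ fun i _ => hL i
  have Lx : ∀ j, MemLp (fun ω => excess a (X j ω)) 2 P := fun j => memLp_excess (LX j) ha
  have LM : ∀ j, MemLp (fun ω => partialSups (fun j => excess a (X j ω)) j) 2 P :=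
    fun j => memLp_partialSups Lx j
  have hint : ∀ i, Integrable (fun ω => partialSups (fun j => excess a (X j ω)) i *
      (excess a (X (i + 1) ω) - excess a (X i ω))) P := fun i =>
    (LM i).integrable_mul ((Lx (i + 1)).sub (Lx i))
  have hincr : ∀ i, 0 ≤ ∫ ω, partialSups (fun j => excess a (X j ω)) i *
      (excess a (X (i + 1) ω) - excess a (X i ω)) ∂P := by
    intro i
    -- By convexity the integrand is at least `W * ξ i`. As `W` depends only on the increments
    -- before `i`, this lower bound has mean zero: the submartingale property in disguise.
    set W : Ω → ℝ := fun ω => partialSups (fun j => excess a (X j ω)) i * excessSlope a (X i ω)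
      with hW
    have LW : MemLp W 2 P := by
      refine (LM i).mono ?_ (ae_of_all _ fun ω => ?_)
      · exact (LM i).1.mul ((measurable_excessSlope a).comp (mX i)).aestronglyMeasurable
      · rw [hW, norm_mul]
        exact mul_le_of_le_one_right (norm_nonneg _) (abs_excessSlope_le _ _)
    have hWξ : IndepFun W (ξ i) P := by
      have h := hind.indepFun_finset (Finset.range i) {i} (by simp) hm
      -- Rebuilds the partial sums up to time `i` from the first `i` increments, which exhibits `W`
      -- as a measurable function of them.
      let past : ((Finset.range i) → ℝ) → ℕ → ℝ := fun z j =>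
        ∑ l : Finset.range i, if l.1 < j then z l else 0
      have hpast : ∀ ω, ∀ j ≤ i, past (fun l => ξ l ω) j = X j ω := by
        intro ω j hj
        simp only [past, hX]
        rw [Finset.sum_coe_sort (Finset.range i) (fun l => if l < j then ξ l ω else 0),
          ← Finset.sum_filter]
        congr 1
        ext l; simp; omega
      have mpast : ∀ j, Measurable fun z => past z j := fun j =>
        Finset.measurable_sum _ fun l _ => by split_ifs <;> fun_prop
      let Φ : ((Finset.range i) → ℝ) → ℝ := fun z =>
        partialSups (fun j => excess a (past z j)) i * excessSlope a (past z i)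
      have mΦ : Measurable Φ :=
        (measurable_partialSups (fun j => (continuous_excess a).measurable.comp (mpast j)) i).mul
          ((measurable_excessSlope a).comp (mpast i))
      have := h.comp mΦ (measurable_pi_apply (⟨i, by simp⟩ : ({i} : Finset ℕ)))
      refine this.congr (ae_of_all _ fun ω => ?_) (ae_of_all _ fun ω => rfl)
      symm
      simp only [hW, Function.comp, Φ]
      rw [hpast ω i le_rfl, partialSups_apply, partialSups_apply]
      congr 1
      refine Finset.sup'_congr _ rfl fun j hj => ?_
      rw [hpast ω j (by simpa using hj)]
    have hz : ∫ ω, W ω * ξ i ω ∂P = 0 := by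
      have := hWξ.integral_mul_eq_mul_integral LW.1 (hL i).1
      simpa [h0 i] using this
    rw [← hz]
    refine integral_mono (LW.integrable_mul (hL i)) (hint i) fun ω => ?_
    have hsucc : X (i + 1) ω = X i ω + ξ i ω := Finset.sum_range_succ _ _
    simp only [hW]
    rw [mul_assoc, hsucc]
    refine mul_le_mul_of_nonneg_left (excessSlope_mul_le ha _ _) ?_
    exact (excess_nonneg _ _).trans
      (le_partialSups_of_le (fun j => excess a (X j ω)) (Nat.zero_le i))
  calc ∫ ω, (partialSups (fun j => excess a (X j ω)) n) ^ 2 ∂P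
      ≤ ∫ ω, (4 * excess a (X n ω) ^ 2 - 4 * ∑ i ∈ Finset.range n,
          partialSups (fun j => excess a (X j ω)) i *
            (excess a (X (i + 1) ω) - excess a (X i ω))) ∂P := by
        refine integral_mono (LM n).integrable_sq ?_ fun ω => partialSups_sq_le _ n
        exact ((Lx n).integrable_sq.const_mul 4).sub
          ((integrable_finsetSum _ fun i _ => hint i).const_mul 4)
    _ = 4 * ∫ ω, excess a (X n ω) ^ 2 ∂P - 4 * ∑ i ∈ Finset.range n,
          ∫ ω, partialSups (fun j => excess a (X j ω)) i *
            (excess a (X (i + 1) ω) - excess a (X i ω)) ∂P := by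
        rw [integral_sub ((Lx n).integrable_sq.const_mul 4)
          ((integrable_finsetSum _ fun i _ => hint i).const_mul 4), integral_const_mul,
          integral_const_mul, integral_finsetSum _ fun i _ => hint i]
    _ ≤ _ := by
        have := Finset.sum_nonneg fun i (_ : i ∈ Finset.range n) => hincr i
        linarith

lemma variance_sum_eq {X : ℕ → Ω → ℝ} (hX : MemLp (X 0) 2 P) (hind : iIndepFun X P)
    (hid : ∀ i, IdentDistrib (X i) (X 0) P P) (n : ℕ) :
    Var[fun ω => ∑ i ∈ Finset.range n, X i ω; P] = n * Var[X 0; P] := by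
  have h := IndepFun.variance_sum (s := Finset.range n) (fun i _ => (hid i).memLp_iff.2 hX)
    (fun i _ j _ hij => hind.indepFun hij)
  rw [Finset.sum_congr rfl fun i _ => (hid i).variance_eq] at h
  have e : (∑ i ∈ Finset.range n, X i) = fun ω => ∑ i ∈ Finset.range n, X i ω := by
    ext ω; simp
  rw [← e, h]
  simp

lemma integral_sum_sq_eq {ξ : ℕ → Ω → ℝ} (hind : iIndepFun ξ P)
    (hid : ∀ i, IdentDistrib (ξ i) (ξ 0) P P) (hL : MemLp (ξ 0) 2 P)
    (h0 : ∫ ω, ξ 0 ω ∂P = 0) (n : ℕ) :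
    ∫ ω, (∑ i ∈ Finset.range n, ξ i ω) ^ 2 ∂P = n * Var[ξ 0; P] := by
  have := hind.isProbabilityMeasure
  have hLi : ∀ i, MemLp (ξ i) 2 P := fun i => (hid i).memLp_iff.2 hL
  rw [← variance_sum_eq hL hind hid, variance_of_integral_eq_zero
    (Finset.aemeasurable_fun_sum _ fun i _ => (hLi i).1.aemeasurable)]
  rw [integral_finsetSum _ fun i _ => (hLi i).integrable (by norm_num)]
  exact Finset.sum_eq_zero fun i _ => (hid i).integral_eq.trans h0

lemma excess_sq_le {a : ℝ} (ha : 0 ≤ a) (y : ℝ) : excess a y ^ 2 ≤ y ^ 2 - min (y ^ 2) (a ^ 2) := by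
  unfold excess
  rcases le_total |y| a with h | h
  · rw [max_eq_right (by linarith)]
    have := min_le_left (y ^ 2) (a ^ 2)
    nlinarith
  · rw [max_eq_left (by linarith)]
    have := min_le_right (y ^ 2) (a ^ 2)
    rw [← sq_abs y] at *
    nlinarith

lemma integral_sq_gaussianReal (v : NNReal) : ∫ y, y ^ 2 ∂(gaussianReal 0 v) = v := by
  have h := variance_id_gaussianReal (μ := 0) (v := v)
  rw [variance_of_integral_eq_zero aemeasurable_id (by simp)] at h
  simpa using h

lemma tendsto_integral_min_sq_gaussianReal (v : NNReal) :
    Tendsto (fun K : ℕ => ∫ y, min (y ^ 2) (K : ℝ) ∂(gaussianReal 0 v)) atTop (𝓝 v) := by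
  rw [← integral_sq_gaussianReal v]
  refine tendsto_integral_of_dominated_convergence (fun y => y ^ 2) (fun K => ?_) ?_
    (fun K => ae_of_all _ fun y => ?_) (ae_of_all _ fun y => ?_)
  · exact (by fun_prop : Continuous fun y : ℝ => min (y ^ 2) (K : ℝ)).aestronglyMeasurable
  · exact (memLp_id_gaussianReal 2).integrable_sq
  · rw [Real.norm_eq_abs, abs_of_nonneg (by positivity)]
    exact min_le_left _ _
  · refine tendsto_const_nhds.congr' ?_
    filter_upwards [eventually_ge_atTop ⌈y ^ 2⌉₊] with K hK
    rw [min_eq_left (Nat.ceil_le.1 hK)]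

variable [IsProbabilityMeasure P]

/-- The squares of normalised sums of i.i.d. centred square integrable variables are uniformly
integrable. -/
lemma tendsto_integral_excess_sq_div {ξ : ℕ → Ω → ℝ}
    (hind : iIndepFun ξ P) (hid : ∀ i, IdentDistrib (ξ i) (ξ 0) P P) (hL : MemLp (ξ 0) 2 P)
    (h0 : ∫ ω, ξ 0 ω ∂P = 0) {c : ℝ} (hc : 0 < c) :
    Tendsto (fun n : ℕ => (∫ ω, (excess (c * n) (∑ i ∈ Finset.range n, ξ i ω)) ^ 2 ∂P) / n)
      atTop (𝓝 0) := by
  set v : NNReal := Var[ξ 0; P].toNNReal with hv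
  have hvv : (v : ℝ) = Var[ξ 0; P] := Real.coe_toNNReal _ (variance_nonneg _ _)
  have hclt := (tendstoInDistribution_inv_sqrt_mul_sum_sub (P' := gaussianReal 0 v) (Y := id)
    HasLaw.id hL hind hid).tendsto
  have LX : ∀ n, MemLp (fun ω => ∑ i ∈ Finset.range n, ξ i ω) 2 P := fun n =>
    memLp_finsetSum _ fun i _ => (hid i).memLp_iff.2 hL
  rw [Metric.tendsto_atTop']
  intro ε hε
  -- The second moment of the normalised sum is exactly `v`, and its truncation at `K` converges to
  -- the Gaussian one, which exceeds `v - ε`. So less than `ε` lies above `K`, and `K ≤ c ^ 2 * n`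
  -- once `n ≥ K / c ^ 2`.
  obtain ⟨K, hK⟩ := ((tendsto_integral_min_sq_gaussianReal v).eventually_const_lt
    (show (v : ℝ) - ε < v by linarith)).exists
  let f : BoundedContinuousFunction ℝ ℝ := BoundedContinuousFunction.ofNormedAddCommGroup
    (fun y => min (y ^ 2) (K : ℝ)) (by fun_prop) K (fun y => by
      rw [Real.norm_eq_abs, abs_of_nonneg (by positivity)]; exact min_le_right _ _)
  have hf := (ProbabilityMeasure.tendsto_iff_forall_integral_tendsto.1 hclt f)
  simp only [ProbabilityMeasure.coe_mk, Measure.map_id] at hf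
  have hf' := hf.eventually_const_lt (show (v : ℝ) - ε < _ from hK)
  obtain ⟨N, hN⟩ := (hf'.and ((eventually_ge_atTop ⌈(K : ℝ) / c ^ 2⌉₊).and
    (eventually_gt_atTop 0))).exists_forall_of_atTop
  refine ⟨N, fun n hn => ?_⟩
  obtain ⟨h1, h2, h3⟩ := hN n hn.le
  have hn0 : (0 : ℝ) < n := by exact_mod_cast h3
  rw [dist_zero_right, Real.norm_eq_abs, abs_of_nonneg (by positivity), ← integral_div]
  rw [integral_map (by
      exact ((LX n).1.aemeasurable.sub_const _).const_mul _) f.continuous.aestronglyMeasurable]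
    at h1
  simp only [h0, mul_zero, sub_zero] at h1
  have hsq : ∀ ω, ((√(n : ℝ))⁻¹ * ∑ i ∈ Finset.range n, ξ i ω) ^ 2 =
      (∑ i ∈ Finset.range n, ξ i ω) ^ 2 / n := fun ω => by
    rw [mul_pow, inv_pow, Real.sq_sqrt hn0.le]; ring
  have hint1 : Integrable (fun ω => (∑ i ∈ Finset.range n, ξ i ω) ^ 2 / (n : ℝ)) P :=
    (LX n).integrable_sq.div_const _
  have hint2 : Integrable
      (fun ω => f ((√(n : ℝ))⁻¹ * ∑ i ∈ Finset.range n, ξ i ω)) P := by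
    refine Integrable.of_bound (f.continuous.comp_aestronglyMeasurable ((LX n).1.const_mul _))
      ‖f‖ (ae_of_all _ fun ω => f.norm_coe_le_norm _)
  calc ∫ ω, (excess (c * n) (∑ i ∈ Finset.range n, ξ i ω)) ^ 2 / n ∂P
      ≤ ∫ ω, ((∑ i ∈ Finset.range n, ξ i ω) ^ 2 / (n : ℝ) -
          f ((√(n : ℝ))⁻¹ * ∑ i ∈ Finset.range n, ξ i ω)) ∂P := by
        refine integral_mono ((memLp_excess (LX n) (by positivity)).integrable_sq.div_const _)
          (hint1.sub hint2) fun ω => ?_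
        have := excess_sq_le (show 0 ≤ c * n by positivity) (∑ i ∈ Finset.range n, ξ i ω)
        change _ ≤ _ - min (((√(n : ℝ))⁻¹ * ∑ i ∈ Finset.range n, ξ i ω) ^ 2) (K : ℝ)
        rw [hsq, le_sub_iff_add_le]
        have h4 : (K : ℝ) ≤ c ^ 2 * n := by
          have := Nat.ceil_le.1 h2
          rw [div_le_iff₀ (by positivity)] at this
          linarith
        have h5 : min ((∑ i ∈ Finset.range n, ξ i ω) ^ 2 / (n : ℝ)) K ≤
            min ((∑ i ∈ Finset.range n, ξ i ω) ^ 2) ((c * n) ^ 2) / n := by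
          rw [← min_div_div_right hn0.le]
          refine min_le_min le_rfl (h4.trans (le_of_eq ?_))
          field_simp
        refine (add_le_add_right h5 _).trans ?_
        rw [← add_div]
        gcongr
        linarith
    _ = Var[ξ 0; P] - ∫ ω, f ((√(n : ℝ))⁻¹ * ∑ i ∈ Finset.range n, ξ i ω) ∂P := by
        rw [integral_sub hint1 hint2, integral_div, integral_sum_sq_eq hind hid hL h0]
        field_simp
    _ < ε := by rw [← hvv]; linarith

end

/-! ### Linearising the norm, and geometry of the triangle of drifts -/

/-- Strict differentiability of the norm at `v` lets both points vary; homogeneity makes `r`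
independent of the scale `n`. -/
lemma norm_sub_norm_le_inner_dir_add {v : Plane} (hv : v ≠ 0) {ε : ℝ} (hε : 0 < ε) :
    ∃ r > 0, ∀ n : ℝ, 0 < n → ∀ x y : Plane, ‖x - n • v‖ ≤ r * n → ‖y - n • v‖ ≤ r * n →
      ‖y‖ - ‖x‖ ≤ inner ℝ (y - x) (dir v) + ε * ‖y - x‖ := by
  have hd : HasStrictFDerivAt (fun x : Plane => ‖x‖) (innerSL ℝ (dir v)) v := by
    have h := (hasStrictFDerivAt_norm_sq v).sqrt (by positivity)
    simp only [Real.sqrt_sq (norm_nonneg _)] at h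
    refine h.congr_fderiv ?_
    rw [dir, map_smul, ← Nat.cast_smul_eq_nsmul ℝ, smul_smul]
    congr 1
    push_cast
    field_simp
  have h := hd.isLittleO.def hε
  obtain ⟨r, hr, hball⟩ := Metric.eventually_nhds_iff.1 h
  refine ⟨r / 2, by positivity, fun n hn x y hx hy => ?_⟩
  have hscale : ∀ z : Plane, ‖z - n • v‖ ≤ r / 2 * n → dist (n⁻¹ • z) v < r := fun z hz => by
    have : n⁻¹ • z - v = n⁻¹ • (z - n • v) := by rw [smul_sub, inv_smul_smul₀ hn.ne']
    rw [dist_eq_norm, this, norm_smul, norm_inv, Real.norm_eq_abs, abs_of_pos hn,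
      inv_mul_lt_iff₀ hn]
    nlinarith
  have := @hball (n⁻¹ • y, n⁻¹ • x) (by
    rw [Prod.dist_eq]; exact max_lt (hscale y hy) (hscale x hx))
  simp only [← smul_sub, norm_smul, norm_inv, Real.norm_eq_abs, abs_of_pos hn, innerSL_apply_apply,
    inner_smul_right] at this
  have h2 := (le_abs_self _).trans this
  rw [real_inner_comm]
  have h3 := mul_le_mul_of_nonneg_left h2 hn.le
  field_simp at h3
  linarith

/-- The triangle with vertices `0`, `m 0`, `m 1`. -/
def vertex (m : Fin 2 → Plane) (T : Option (Fin 2)) : Plane := T.elim 0 m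

/-- The side `A B` of the triangle is longer than all others by at least `γ`. -/
def LongestSide (m : Fin 2 → Plane) (A B : Option (Fin 2)) (γ : ℝ) : Prop :=
  ∀ C D, (C, D) ≠ (A, B) → (C, D) ≠ (B, A) →
    ‖vertex m C - vertex m D‖ + γ ≤ ‖vertex m A - vertex m B‖

/-- The index `i` of the walk `a` is within `δ * n` of the end of the two walks labelled by `T`,
where `none` stands for their common starting point. -/
def Near (δ : ℝ) (n : ℕ) (T : Option (Fin 2)) (a : Fin 2) (i : ℕ) : Prop :=
  match T with
  | none => (i : ℝ) ≤ δ * n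
  | some k => a = k ∧ (n : ℝ) ≤ i + δ * n

section

variable {m : Fin 2 → Plane} {A B : Option (Fin 2)} {γ δ : ℝ} {n : ℕ}

/-- The degenerate side from `A` to `A` is among the competitors. -/
lemma LongestSide.le (h : LongestSide m A B γ) : γ ≤ ‖vertex m A - vertex m B‖ ∨ A = B := by
  by_cases hAB : A = B
  · exact Or.inr hAB
  · left
    have := h A A (by simp [hAB]) (by simp [hAB])
    simpa using this

lemma LongestSide.side_le (h : LongestSide m A B γ) (hγ : 0 ≤ γ) (C D : Option (Fin 2)) :
    ‖vertex m C - vertex m D‖ ≤ ‖vertex m A - vertex m B‖ := by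
  by_cases h1 : (C, D) = (A, B)
  · simp only [Prod.mk.injEq] at h1; rw [h1.1, h1.2]
  by_cases h2 : (C, D) = (B, A)
  · simp only [Prod.mk.injEq] at h2; rw [h2.1, h2.2, norm_sub_rev]
  linarith [h C D h1 h2]

/-- For `i ≤ j` the vector is `i` times the side from `b` to `a` plus `j - i` times the side from
`b` to the origin, and `n - j` units of time remain unused. Each weight not put on the longest side
costs at least `γ` per unit. -/
lemma LongestSide.norm_smul_sub_smul_le_of_le (h : LongestSide m A B γ) (hAB : A ≠ B) (hγ : 0 ≤ γ)
    (hδ1 : δ ≤ 1) {a b : Fin 2} {i j : ℕ} (hij : i ≤ j) (hj : j ≤ n) :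
    ‖(i : ℝ) • m a - (j : ℝ) • m b‖ ≤ n * ‖vertex m A - vertex m B‖ ∧
      (‖(i : ℝ) • m a - (j : ℝ) • m b‖ ≤ n * (‖vertex m A - vertex m B‖ - γ * δ) ∨
        (Near δ n A a i ∧ Near δ n B b j) ∨ (Near δ n B a i ∧ Near δ n A b j)) := by
  have hij' : (0 : ℝ) ≤ j - i := by have : (i : ℝ) ≤ j := by exact_mod_cast hij
                                    linarith
  have hj' : (0 : ℝ) ≤ n - j := by have : (j : ℝ) ≤ n := by exact_mod_cast hj
                                   linarith
  have hi0 : (0 : ℝ) ≤ i := Nat.cast_nonneg i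
  have hn0 : (0 : ℝ) ≤ n := Nat.cast_nonneg n
  have hL := h.le.resolve_right hAB
  set L := ‖vertex m A - vertex m B‖
  have hw : ‖(i : ℝ) • m a - (j : ℝ) • m b‖ ≤ i * ‖vertex m (some a) - vertex m (some b)‖ +
      (j - i) * ‖vertex m none - vertex m (some b)‖ := by
    have : (i : ℝ) • m a - (j : ℝ) • m b = (i : ℝ) • (vertex m (some a) - vertex m (some b)) +
        ((j : ℝ) - i) • (vertex m none - vertex m (some b)) := by
      simp only [vertex, Option.elim]; module
    rw [this]
    refine (norm_add_le _ _).trans ?_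
    rw [norm_smul, norm_smul, Real.norm_of_nonneg hi0, Real.norm_of_nonneg hij']
  have h1 := h.side_le hγ (some a) (some b)
  have h2 := h.side_le hγ none (some b)
  have hm1 := mul_le_mul_of_nonneg_left h1 hi0
  have hm2 := mul_le_mul_of_nonneg_left h2 hij'
  have hL0 : 0 ≤ L := norm_nonneg _
  refine ⟨by nlinarith, ?_⟩
  have hγδ : γ * δ ≤ γ := mul_le_of_le_one_right hγ hδ1
  by_cases e1 : (some a, some b) = (A, B) ∨ (some a, some b) = (B, A)
  · have e2 : ‖vertex m none - vertex m (some b)‖ + γ ≤ L := by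
      refine h _ _ ?_ ?_ <;> rcases e1 with e | e <;> simp only [Prod.mk.injEq] at e <;>
        simp [← e.1, ← e.2]
    by_cases hnear : (n : ℝ) ≤ i + δ * n
    · right
      rcases e1 with e | e <;> simp only [Prod.mk.injEq] at e <;> rw [← e.1, ← e.2] <;>
        simp only [Near]
      · exact Or.inl ⟨⟨trivial, hnear⟩, trivial, by linarith⟩
      · exact Or.inr ⟨⟨trivial, hnear⟩, trivial, by linarith⟩
    -- The loss is at least `γ (j - i) + L (n - j) ≥ γ (n - i)`.
    · left
      have := mul_le_mul_of_nonneg_left e2 hij'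
      have h3 := mul_le_mul_of_nonneg_left hL hj'
      have h4 := mul_le_mul_of_nonneg_left (not_le.1 hnear).le hγ
      nlinarith
  by_cases e2 : (none, some b) = (A, B) ∨ (none, some b) = (B, A)
  · have e3 : ‖vertex m (some a) - vertex m (some b)‖ + γ ≤ L := by
      push Not at e1
      exact h _ _ e1.1 e1.2
    by_cases hnear : (i : ℝ) ≤ δ * n ∧ (n : ℝ) ≤ j + δ * n
    · right
      rcases e2 with e | e <;> simp only [Prod.mk.injEq] at e <;> rw [← e.1, ← e.2] <;>
        simp only [Near]
      · exact Or.inl ⟨hnear.1, trivial, hnear.2⟩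
      · exact Or.inr ⟨hnear.1, trivial, hnear.2⟩
    · left
      have := mul_le_mul_of_nonneg_left e3 hi0
      have h3 := mul_le_mul_of_nonneg_left hL hj'
      have h4 : γ * (δ * n) ≤ γ * (i + (n - j)) := by
        refine mul_le_mul_of_nonneg_left ?_ hγ
        rw [not_and_or] at hnear
        rcases hnear with h | h <;> linarith
      nlinarith
  -- Neither side is the longest, so every unit of time costs `γ` and the loss is at least `γ n`.
  · left
    push Not at e1 e2
    have g1 := mul_le_mul_of_nonneg_left (h _ _ e1.1 e1.2) hi0
    have g2 := mul_le_mul_of_nonneg_left (h _ _ e2.1 e2.2) hij'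
    have h3 := mul_le_mul_of_nonneg_left hL hj'
    have h4 := mul_le_mul_of_nonneg_left hγδ hn0
    nlinarith

/-- If two points of the averaged walks up to time `n` are nearly as far apart as possible, then
they are close to the two endpoints of the longest side. -/
lemma LongestSide.norm_smul_sub_smul_le (h : LongestSide m A B γ) (hAB : A ≠ B) (hγ : 0 ≤ γ)
    (hδ1 : δ ≤ 1) {a b : Fin 2} {i j : ℕ} (hi : i ≤ n) (hj : j ≤ n) :
    ‖(i : ℝ) • m a - (j : ℝ) • m b‖ ≤ n * ‖vertex m A - vertex m B‖ ∧
      (‖(i : ℝ) • m a - (j : ℝ) • m b‖ ≤ n * (‖vertex m A - vertex m B‖ - γ * δ) ∨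
        (Near δ n A a i ∧ Near δ n B b j) ∨ (Near δ n B a i ∧ Near δ n A b j)) := by
  rcases le_total i j with hij | hij
  · exact h.norm_smul_sub_smul_le_of_le hAB hγ hδ1 hij hj
  · have := h.norm_smul_sub_smul_le_of_le hAB hγ hδ1 (a := b) (b := a) hij hi
    rw [norm_sub_rev ((i : ℝ) • m a)]
    tauto

/-- The ends of the two walks at time `n`, with `none` standing for the starting point. -/
def endPoint (S : Fin 2 → ℕ → Plane) (n : ℕ) (T : Option (Fin 2)) : Plane :=
  T.elim 0 fun k => S k n

variable {S : Fin 2 → ℕ → Plane} {K M I : ℝ}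

lemma norm_mean_sub_vertex_le_of_near (hK : ∀ k, ‖m k‖ ≤ K) {T : Option (Fin 2)} {a : Fin 2}
    {i : ℕ} (hi : i ≤ n) (hT : Near δ n T a i) :
    ‖(i : ℝ) • m a - (n : ℝ) • vertex m T‖ ≤ δ * n * K := by
  have hK0 : 0 ≤ K := (norm_nonneg _).trans (hK 0)
  cases T with
  | none =>
    simp only [Near] at hT
    simp only [vertex, Option.elim, smul_zero, sub_zero, norm_smul, Real.norm_natCast]
    exact mul_le_mul hT (hK a) (norm_nonneg _) ((Nat.cast_nonneg i).trans hT)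
  | some k =>
    obtain ⟨rfl, hT⟩ := hT
    have hi' : (i : ℝ) ≤ n := by exact_mod_cast hi
    simp only [vertex, Option.elim, ← sub_smul, norm_smul, Real.norm_eq_abs]
    refine mul_le_mul ?_ (hK a) (norm_nonneg _) (by linarith)
    rw [abs_sub_comm, abs_of_nonneg] <;> linarith

lemma norm_fluctuation_sub_le_of_near
    (hI0 : ∀ k, ∀ j ≤ n, (j : ℝ) ≤ δ * n → ‖S k j - (j : ℝ) • m k‖ ≤ I)
    (hI1 : ∀ k, ∀ j ≤ n, (n : ℝ) ≤ j + δ * n →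
      ‖(S k j - (j : ℝ) • m k) - (S k n - (n : ℝ) • m k)‖ ≤ I)
    {T : Option (Fin 2)} {a : Fin 2} {i : ℕ} (hi : i ≤ n) (hT : Near δ n T a i) :
    ‖(S a i - (i : ℝ) • m a) - (endPoint S n T - (n : ℝ) • vertex m T)‖ ≤ I := by
  cases T with
  | none => simpa [endPoint, vertex] using hI0 a i hi hT
  | some k =>
    obtain ⟨rfl, hT⟩ := hT
    exact hI1 a i hi hT

lemma norm_endPoint_sub_le (hM0 : 0 ≤ M) (hM : ∀ k, ‖S k n - (n : ℝ) • m k‖ ≤ M)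
    (T : Option (Fin 2)) : ‖endPoint S n T - (n : ℝ) • vertex m T‖ ≤ M := by
  cases T with
  | none => simpa [endPoint, vertex] using hM0
  | some k => exact hM k

lemma inner_dir_self {v : Plane} (hv : v ≠ 0) : inner ℝ v (dir v) = ‖v‖ := by
  simp only [dir, inner_smul_right, real_inner_self_eq_norm_sq]
  field_simp

lemma norm_dir {v : Plane} (hv : v ≠ 0) : ‖dir v‖ = 1 := by
  rw [dir, norm_smul, norm_inv, norm_norm, inv_mul_cancel₀ (norm_ne_zero_iff.2 hv)]

lemma neg_norm_le_inner_dir {v : Plane} (hv : v ≠ 0) (g : Plane) : -‖g‖ ≤ inner ℝ g (dir v) := by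
  have := neg_le_of_abs_le (abs_real_inner_le_norm g (dir v))
  rwa [norm_dir hv, mul_one] at this

lemma inner_dir_le_norm {v : Plane} (hv : v ≠ 0) (g : Plane) : inner ℝ g (dir v) ≤ ‖g‖ := by
  have := real_inner_le_norm g (dir v)
  rwa [norm_dir hv, mul_one] at this

/-- The norm is linearised between the mean difference `x` and the actual one. The term `-n ‖v‖`
from the projection absorbs `‖x‖ ≤ n ‖v‖`, so no error of order `δ n` survives from the mean;
replacing the fluctuations by those at the end points costs `2 I`. -/
lemma norm_sub_le_of_near (hv : vertex m A - vertex m B ≠ 0) {ε r : ℝ} (hε : 0 ≤ ε)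
    (hr : ∀ n : ℝ, 0 < n → ∀ x y : Plane, ‖x - n • (vertex m A - vertex m B)‖ ≤ r * n →
      ‖y - n • (vertex m A - vertex m B)‖ ≤ r * n →
      ‖y‖ - ‖x‖ ≤ inner ℝ (y - x) (dir (vertex m A - vertex m B)) + ε * ‖y - x‖)
    (hn : 0 < n) (hK : ∀ k, ‖m k‖ ≤ K) (hδ : 4 * (δ * K) ≤ r)
    (hM : ∀ k, ∀ j ≤ n, ‖S k j - (j : ℝ) • m k‖ ≤ M) (hMr : 4 * M ≤ r * n)
    (hI0 : ∀ k, ∀ j ≤ n, (j : ℝ) ≤ δ * n → ‖S k j - (j : ℝ) • m k‖ ≤ I)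
    (hI1 : ∀ k, ∀ j ≤ n, (n : ℝ) ≤ j + δ * n →
      ‖(S k j - (j : ℝ) • m k) - (S k n - (n : ℝ) • m k)‖ ≤ I)
    {a b : Fin 2} {i j : ℕ} (hi : i ≤ n) (hj : j ≤ n) (hA : Near δ n A a i) (hB : Near δ n B b j)
    (hw : ‖(i : ℝ) • m a - (j : ℝ) • m b‖ ≤ n * ‖vertex m A - vertex m B‖) :
    ‖S a i - S b j‖ ≤ inner ℝ (endPoint S n A - endPoint S n B) (dir (vertex m A - vertex m B)) +
      2 * I + 2 * ε * M := by
  have hn0 : (0 : ℝ) < n := by exact_mod_cast hn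
  have a1 := norm_mean_sub_vertex_le_of_near hK hi hA
  have b1 := norm_mean_sub_vertex_le_of_near hK hj hB
  have a2 := norm_fluctuation_sub_le_of_near hI0 hI1 hi hA
  have b2 := norm_fluctuation_sub_le_of_near hI0 hI1 hj hB
  have a3 := hM a i hi
  have b3 := hM b j hj
  have hδn := mul_le_mul_of_nonneg_right hδ hn0.le
  set v := vertex m A - vertex m B with hvdef
  set x := (i : ℝ) • m a - (j : ℝ) • m b with hx
  have hxv : ‖x - (n : ℝ) • v‖ ≤ 2 * (δ * n * K) := by
    have : x - (n : ℝ) • v = ((i : ℝ) • m a - (n : ℝ) • vertex m A) -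
        ((j : ℝ) • m b - (n : ℝ) • vertex m B) := by rw [hx, hvdef]; module
    rw [this]
    linarith [norm_sub_le ((i : ℝ) • m a - (n : ℝ) • vertex m A)
      ((j : ℝ) • m b - (n : ℝ) • vertex m B)]
  have hyx : ‖S a i - S b j - x‖ ≤ 2 * M := by
    have : S a i - S b j - x = (S a i - (i : ℝ) • m a) - (S b j - (j : ℝ) • m b) := by
      rw [hx]; module
    rw [this]
    linarith [norm_sub_le (S a i - (i : ℝ) • m a) (S b j - (j : ℝ) • m b)]
  have hM0 : 0 ≤ M := (norm_nonneg _).trans a3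
  have key := hr n hn0 x (S a i - S b j) (by linarith) (by
    have : S a i - S b j - (n : ℝ) • v = (S a i - S b j - x) + (x - (n : ℝ) • v) := by module
    rw [this]
    linarith [norm_add_le (S a i - S b j - x) (x - (n : ℝ) • v)])
  have hε' := mul_le_mul_of_nonneg_left hyx hε
  have hdec : S a i - S b j - x = (endPoint S n A - endPoint S n B) - (n : ℝ) • v +
      (((S a i - (i : ℝ) • m a) - (endPoint S n A - (n : ℝ) • vertex m A)) -
        ((S b j - (j : ℝ) • m b) - (endPoint S n B - (n : ℝ) • vertex m B))) := by
    rw [hx, hvdef]; module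
  rw [hdec, inner_add_left, inner_sub_left _ ((n : ℝ) • v), inner_smul_left, inner_dir_self hv,
    ← hdec] at key
  have h5 := inner_dir_le_norm hv
    (((S a i - (i : ℝ) • m a) - (endPoint S n A - (n : ℝ) • vertex m A)) -
        ((S b j - (j : ℝ) • m b) - (endPoint S n B - (n : ℝ) • vertex m B)))
  have h6 := norm_sub_le ((S a i - (i : ℝ) • m a) - (endPoint S n A - (n : ℝ) • vertex m A))
        ((S b j - (j : ℝ) • m b) - (endPoint S n B - (n : ℝ) • vertex m B))
  simp only [conj_trivial] at key
  linarith

lemma LongestSide.norm_sub_le_inner_add (h : LongestSide m A B γ) (hγ : 0 ≤ γ)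
    (hv : vertex m A - vertex m B ≠ 0) {ε r ρ : ℝ} (hε : 0 ≤ ε)
    (hr : ∀ n : ℝ, 0 < n → ∀ x y : Plane, ‖x - n • (vertex m A - vertex m B)‖ ≤ r * n →
      ‖y - n • (vertex m A - vertex m B)‖ ≤ r * n →
      ‖y‖ - ‖x‖ ≤ inner ℝ (y - x) (dir (vertex m A - vertex m B)) + ε * ‖y - x‖)
    (hn : 0 < n) (hK : ∀ k, ‖m k‖ ≤ K) (hδ0 : 0 ≤ δ) (hδ1 : δ ≤ 1) (hδ : 4 * (δ * K) ≤ r)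
    (hρr : 8 * ρ ≤ r) (hργ : 8 * ρ ≤ γ * δ)
    (hM : ∀ k, ∀ j ≤ n, ‖S k j - (j : ℝ) • m k‖ ≤ M)
    (hI0 : ∀ k, ∀ j ≤ n, (j : ℝ) ≤ δ * n → ‖S k j - (j : ℝ) • m k‖ ≤ I)
    (hI1 : ∀ k, ∀ j ≤ n, (n : ℝ) ≤ j + δ * n →
      ‖(S k j - (j : ℝ) • m k) - (S k n - (n : ℝ) • m k)‖ ≤ I)
    {a b : Fin 2} {i j : ℕ} (hi : i ≤ n) (hj : j ≤ n) :
    ‖S a i - S b j‖ ≤ inner ℝ (endPoint S n A - endPoint S n B) (dir (vertex m A - vertex m B)) +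
      2 * I + 2 * ε * M + 8 * excess (ρ * n) M := by
  have hn0 : (0 : ℝ) < n := by exact_mod_cast hn
  have hAB : A ≠ B := by rintro rfl; simp at hv
  have hM0 : 0 ≤ M := (norm_nonneg _).trans (hM 0 n le_rfl)
  have hI' : 0 ≤ I := (norm_nonneg _).trans (hI1 0 n le_rfl (by nlinarith))
  have hεM : 0 ≤ ε * M := mul_nonneg hε hM0
  have hex : M - ρ * n ≤ excess (ρ * n) M := by
    refine le_trans ?_ (le_max_left _ _); linarith [le_abs_self M]
  have hex0 := excess_nonneg (ρ * n) M
  have crude : ‖S a i - S b j‖ ≤ ‖(i : ℝ) • m a - (j : ℝ) • m b‖ + 2 * M := by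
    have : S a i - S b j = ((i : ℝ) • m a - (j : ℝ) • m b) +
        ((S a i - (i : ℝ) • m a) - (S b j - (j : ℝ) • m b)) := by module
    rw [this]
    linarith [norm_add_le ((i : ℝ) • m a - (j : ℝ) • m b)
      ((S a i - (i : ℝ) • m a) - (S b j - (j : ℝ) • m b)),
      norm_sub_le (S a i - (i : ℝ) • m a) (S b j - (j : ℝ) • m b), hM a i hi, hM b j hj]
  have hend : n * ‖vertex m A - vertex m B‖ - 2 * M ≤
      inner ℝ (endPoint S n A - endPoint S n B) (dir (vertex m A - vertex m B)) := by
    have : endPoint S n A - endPoint S n B = (n : ℝ) • (vertex m A - vertex m B) +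
        ((endPoint S n A - (n : ℝ) • vertex m A) - (endPoint S n B - (n : ℝ) • vertex m B)) := by
      module
    rw [this, inner_add_left, inner_smul_left, inner_dir_self hv]
    simp only [conj_trivial]
    linarith [neg_norm_le_inner_dir hv ((endPoint S n A - (n : ℝ) • vertex m A) -
      (endPoint S n B - (n : ℝ) • vertex m B)), norm_sub_le (endPoint S n A - (n : ℝ) • vertex m A)
      (endPoint S n B - (n : ℝ) • vertex m B),
      norm_endPoint_sub_le hM0 (fun k => hM k n le_rfl) A,
      norm_endPoint_sub_le hM0 (fun k => hM k n le_rfl) B]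
  obtain ⟨hle, hcase⟩ := h.norm_smul_sub_smul_le hAB hγ hδ1 (a := a) (b := b) hi hj
  by_cases hMr : 4 * M ≤ r * n
  -- Far from the ends, `crude` and `hend` give an error of at most `4 M - γ δ n`, hence at most `8
  -- (M - ρ n)` because `8 ρ ≤ γ δ`.
  · rcases hcase with hfar | ⟨hA, hB⟩ | ⟨hB, hA⟩
    · have := mul_le_mul_of_nonneg_right hργ hn0.le
      linarith
    · linarith [norm_sub_le_of_near hv hε hr hn hK hδ hM hMr hI0 hI1 hi hj hA hB hle]
    · rw [norm_sub_rev] at hle ⊢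
      linarith [norm_sub_le_of_near hv hε hr hn hK hδ hM hMr hI0 hI1 hj hi hA hB hle]
  -- Here `4 M > r n ≥ 8 ρ n`, so the crude error `4 M` is at most `8 (M - ρ n)`.
  · have := mul_le_mul_of_nonneg_right hρr hn0.le
    linarith

end

/-! ### Running maxima of partial sums -/

/-- The running maximum of the excess over the level `a` of the partial sums of `x`. -/
noncomputable def maxExcess (x : ℕ → ℝ) (a : ℝ) (n : ℕ) : ℝ :=
  partialSups (fun j => excess a (∑ i ∈ Finset.range j, x i)) n

lemma maxExcess_nonneg (x : ℕ → ℝ) (a : ℝ) (n : ℕ) : 0 ≤ maxExcess x a n :=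
  (excess_nonneg _ _).trans
    (le_partialSups_of_le (fun j => excess a (∑ i ∈ Finset.range j, x i)) (Nat.zero_le n))

lemma abs_sum_le_maxExcess (x : ℕ → ℝ) {j n : ℕ} (hj : j ≤ n) :
    |∑ i ∈ Finset.range j, x i| ≤ maxExcess x 0 n := by
  refine le_trans ?_ (le_partialSups_of_le (fun j => excess 0 (∑ i ∈ Finset.range j, x i)) hj)
  simp [excess]

/-- Both sums are compared with the one at time `n - d`, whence the factor `2`. The window at the
end thus becomes an initial window of the shifted sequence, to which Doob's inequality applies. -/
lemma abs_sum_sub_sum_le_maxExcess (x : ℕ → ℝ) {j n d : ℕ} (hj : j ≤ n) (hd : n - d ≤ j)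
    (hdn : d ≤ n) :
    |∑ i ∈ Finset.range j, x i - ∑ i ∈ Finset.range n, x i| ≤
      2 * maxExcess (fun i => x (n - d + i)) 0 d := by
  have h : ∀ l, ∑ i ∈ Finset.range (n - d + l), x i = ∑ i ∈ Finset.range (n - d), x i +
      ∑ i ∈ Finset.range l, x (n - d + i) := fun l => Finset.sum_range_add _ _ _
  obtain ⟨l, rfl⟩ := Nat.exists_eq_add_of_le hd
  have hl : l ≤ d := by omega
  have hn : n = n - d + d := by omega
  have h2 := h d
  rw [← hn] at h2
  rw [h l, h2]
  have a1 := abs_le.1 (abs_sum_le_maxExcess (fun i => x (n - d + i)) hl)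
  have a2 := abs_le.1 (abs_sum_le_maxExcess (fun i => x (n - d + i)) (le_refl d))
  rw [abs_le]
  constructor <;> linarith [a1.1, a1.2, a2.1, a2.2]

lemma maxExcess_zero_sub_le (x : ℕ → ℝ) (a : ℝ) (n : ℕ) :
    maxExcess x 0 n - a ≤ maxExcess x a n := by
  rw [sub_le_iff_le_add, maxExcess]
  refine partialSups_le _ _ _ fun j hj => ?_
  rw [← sub_le_iff_le_add]
  refine le_trans ?_ (le_partialSups_of_le (fun j => excess a (∑ i ∈ Finset.range j, x i)) hj)
  simp [excess]

section

variable {Ω : Type*} [MeasurableSpace Ω] {P : Measure Ω} {ξ : ℕ → Ω → ℝ}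

lemma memLp_maxExcess (hL : ∀ i, MemLp (ξ i) 2 P) {a : ℝ} (ha : 0 ≤ a) (n : ℕ) :
    MemLp (fun ω => maxExcess (fun i => ξ i ω) a n) 2 P :=
  memLp_partialSups (f := fun j ω => excess a (∑ i ∈ Finset.range j, ξ i ω))
    (fun _ => memLp_excess (memLp_finsetSum _ fun i _ => hL i) ha) n

lemma integral_maxExcess_shift_sq_le (hm : ∀ i, Measurable (ξ i)) (hind : iIndepFun ξ P)
    (hid : ∀ i, IdentDistrib (ξ i) (ξ 0) P P) (hL : MemLp (ξ 0) 2 P)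
    (h0 : ∫ ω, ξ 0 ω ∂P = 0) (s n : ℕ) :
    ∫ ω, maxExcess (fun i => ξ (s + i) ω) 0 n ^ 2 ∂P ≤ 4 * (n * Var[ξ 0; P]) := by
  have hind' : iIndepFun (fun i => ξ (s + i)) P := hind.precomp (add_right_injective s)
  have hs : ∀ i, IdentDistrib (ξ (s + i)) (ξ (s + 0)) P P := fun i => (hid _).trans (hid _).symm
  have h0' : ∀ i, ∫ ω, ξ i ω ∂P = 0 := fun i => (hid i).integral_eq.trans h0
  refine (integral_partialSups_excess_sq_le (fun i => hm (s + i)) hind'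
    (fun i => (hid _).memLp_iff.2 hL) (fun i => h0' _) le_rfl n).trans (le_of_eq ?_)
  rw [← (hid (s + 0)).variance_eq,
    ← integral_sum_sq_eq hind' hs ((hid _).memLp_iff.2 hL) (h0' _) n]
  simp [excess]

variable [IsProbabilityMeasure P]

lemma tendsto_integral_maxExcess_sq_div (hm : ∀ i, Measurable (ξ i)) (hind : iIndepFun ξ P)
    (hid : ∀ i, IdentDistrib (ξ i) (ξ 0) P P) (hL : MemLp (ξ 0) 2 P)
    (h0 : ∫ ω, ξ 0 ω ∂P = 0) {c : ℝ} (hc : 0 < c) :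
    Tendsto (fun n : ℕ => (∫ ω, maxExcess (fun i => ξ i ω) (c * n) n ^ 2 ∂P) / n)
      atTop (𝓝 0) := by
  have h := (tendsto_integral_excess_sq_div hind hid hL h0 hc).const_mul 4
  rw [mul_zero] at h
  refine squeeze_zero (fun n => by positivity) (fun n => ?_) h
  rw [← mul_div_assoc]
  gcongr
  exact integral_partialSups_excess_sq_le hm hind (fun i => (hid _).memLp_iff.2 hL)
    (fun i => (hid i).integral_eq.trans h0) (by positivity) n

end

/-! ### The diameter as a finite maximum: measurability and second moments -/

section Diameter

variable {Ω : Type*} {Z : Fin 2 → ℕ → Ω → Plane}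

lemma finite_walkPoints (n : ℕ) (ω : Ω) :
    {x : Plane | ∃ k : Fin 2, ∃ j : ℕ, j ≤ n ∧ x = walk (Z k) j ω}.Finite := by
  have : {x : Plane | ∃ k : Fin 2, ∃ j : ℕ, j ≤ n ∧ x = walk (Z k) j ω} ⊆
      (fun p : Fin 2 × ℕ => walk (Z p.1) p.2 ω) '' (Set.univ ×ˢ Set.Iic n) := by
    rintro x ⟨k, j, hj, rfl⟩
    exact ⟨(k, j), by simpa using hj, rfl⟩
  exact ((Set.finite_univ.prod (Set.finite_Iic n)).image _).subset this

lemma norm_walk_sub_walk_le_diameter (n : ℕ) (ω : Ω) {a b : Fin 2} {i j : ℕ} (hi : i ≤ n)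
    (hj : j ≤ n) : ‖walk (Z a) i ω - walk (Z b) j ω‖ ≤ diameter Z n ω := by
  rw [diameter, convexHull_diam, ← dist_eq_norm]
  exact Metric.dist_le_diam_of_mem (finite_walkPoints n ω).isBounded ⟨a, i, hi, rfl⟩ ⟨b, j, hj, rfl⟩

lemma diameter_le {n : ℕ} {ω : Ω} {C : ℝ}
    (h : ∀ a b : Fin 2, ∀ i ≤ n, ∀ j ≤ n, ‖walk (Z a) i ω - walk (Z b) j ω‖ ≤ C) :
    diameter Z n ω ≤ C := by
  rw [diameter, convexHull_diam]
  refine Metric.diam_le_of_forall_dist_le ((norm_nonneg _).trans (h 0 0 0 n.zero_le 0 n.zero_le)) ?_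
  rintro x ⟨a, i, hi, rfl⟩ y ⟨b, j, hj, rfl⟩
  rw [dist_eq_norm]
  exact h a b i hi j hj

lemma diameter_nonneg (n : ℕ) (ω : Ω) : 0 ≤ diameter Z n ω := Metric.diam_nonneg

lemma diameter_eq_sup' (n : ℕ) (ω : Ω) :
    diameter Z n ω = ((Finset.univ ×ˢ Finset.range (n + 1)) ×ˢ
      (Finset.univ ×ˢ Finset.range (n + 1)) : Finset ((Fin 2 × ℕ) × (Fin 2 × ℕ))).sup'
        ⟨((0, 0), (0, 0)), by simp⟩
        (fun p => ‖walk (Z p.1.1) p.1.2 ω - walk (Z p.2.1) p.2.2 ω‖) := by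
  refine le_antisymm (diameter_le fun a b i hi j hj => ?_) (Finset.sup'_le _ _ fun p hp => ?_)
  · exact Finset.le_sup' (fun p : (Fin 2 × ℕ) × (Fin 2 × ℕ) =>
      ‖walk (Z p.1.1) p.1.2 ω - walk (Z p.2.1) p.2.2 ω‖) (b := ((a, i), (b, j)))
      (by simp; omega)
  · simp only [Finset.mem_product, Finset.mem_univ, Finset.mem_range, true_and] at hp
    exact norm_walk_sub_walk_le_diameter n ω (by omega) (by omega)

lemma norm_walk_le (k : Fin 2) {j n : ℕ} (hj : j ≤ n) (ω : Ω) :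
    ‖walk (Z k) j ω‖ ≤ ∑ k, ∑ i ∈ Finset.range n, ‖Z k i ω‖ :=
  calc ‖walk (Z k) j ω‖ ≤ ∑ i ∈ Finset.range j, ‖Z k i ω‖ := norm_sum_le _ _
    _ ≤ ∑ i ∈ Finset.range n, ‖Z k i ω‖ :=
      Finset.sum_le_sum_of_subset_of_nonneg (Finset.range_mono hj) fun _ _ _ => norm_nonneg _
    _ ≤ _ := Finset.single_le_sum (f := fun k => ∑ i ∈ Finset.range n, ‖Z k i ω‖)
      (fun _ _ => Finset.sum_nonneg fun _ _ => norm_nonneg _) (Finset.mem_univ k)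

variable [MeasurableSpace Ω] {P : Measure Ω}

lemma measurable_walk {step : ℕ → Ω → Plane} (h : ∀ i, Measurable (step i)) (n : ℕ) :
    Measurable (walk step n) :=
  Finset.measurable_sum _ fun i _ => h i

lemma measurable_finset_sup' {ι : Type*} {s : Finset ι} (hs : s.Nonempty) {f : ι → Ω → ℝ}
    (hf : ∀ i, Measurable (f i)) : Measurable fun ω => s.sup' hs fun i => f i ω := by
  induction hs using Finset.Nonempty.cons_induction with
  | singleton a => simpa using hf a
  | cons a s ha hs ih =>
    simp only [Finset.sup'_cons hs]
    exact (hf a).sup ih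

lemma measurable_diameter (hm : ∀ k i, Measurable (Z k i)) (n : ℕ) :
    Measurable (diameter Z n) := by
  have : diameter Z n = fun ω => _ := funext fun ω => diameter_eq_sup' n ω
  rw [this]
  exact measurable_finset_sup' _ fun p : (Fin 2 × ℕ) × (Fin 2 × ℕ) =>
    ((measurable_walk (hm p.1.1) p.1.2).sub (measurable_walk (hm p.2.1) p.2.2)).norm

lemma memLp_diameter (hm : ∀ k i, Measurable (Z k i)) (hL : ∀ k i, MemLp (Z k i) 2 P) (n : ℕ) :
    MemLp (diameter Z n) 2 P := by
  have hb : MemLp (fun ω => 2 * ∑ k, ∑ i ∈ Finset.range n, ‖Z k i ω‖) 2 P :=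
    (memLp_finsetSum _ fun k _ => memLp_finsetSum _ fun i _ => (hL k i).norm).const_mul 2
  refine hb.mono (measurable_diameter hm n).aestronglyMeasurable (ae_of_all _ fun ω => ?_)
  rw [Real.norm_of_nonneg (diameter_nonneg n ω)]
  refine le_trans (diameter_le fun a b i hi j hj => ?_) (le_abs_self _)
  linarith [norm_sub_le (walk (Z a) i ω) (walk (Z b) j ω), norm_walk_le a hi ω (Z := Z),
    norm_walk_le b hj ω (Z := Z)]

end Diameter

/-! ### The remainder is small in L² -/

/-- Reduces planar fluctuations to coordinates, where the real-valued Doob inequality applies. -/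
lemma norm_le_sum_abs (x : Plane) : ‖x‖ ≤ ∑ c, |x c| := by
  rw [EuclideanSpace.norm_eq]
  refine Real.sqrt_le_iff.2 ⟨Finset.sum_nonneg fun _ _ => abs_nonneg _, ?_⟩
  simp only [Fin.sum_univ_two, Real.norm_eq_abs]
  nlinarith [abs_nonneg (x 0), abs_nonneg (x 1), mul_nonneg (abs_nonneg (x 0)) (abs_nonneg (x 1))]

section Remainder

variable {Ω : Type*} [MeasurableSpace Ω] {P : Measure Ω} {Z : Fin 2 → ℕ → Ω → Plane}

/-- The coordinates of the centred steps of the two walks. -/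
noncomputable def centred (P : Measure Ω) (Z : Fin 2 → ℕ → Ω → Plane) (q : Fin 2 × Fin 2) (i : ℕ) (ω : Ω) : ℝ :=
  Z q.1 i ω q.2 - drift P Z q.1 q.2

lemma measurable_centred (hm : ∀ k i, Measurable (Z k i)) (q : Fin 2 × Fin 2) (i : ℕ) :
    Measurable (centred P Z q i) :=
  ((by fun_prop : Measurable fun x : Plane => x q.2).comp (hm q.1 i)).sub_const _

lemma iIndepFun_centred (hind : iIndepFun (fun p : Fin 2 × ℕ => Z p.1 p.2) P) (q : Fin 2 × Fin 2) :
    iIndepFun (centred P Z q) P :=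
  (hind.precomp (g := fun i : ℕ => (q.1, i)) (fun i j h => (Prod.mk.inj h).2)).comp
    (fun _ (x : Plane) => x q.2 - drift P Z q.1 q.2) fun _ => by fun_prop

lemma identDistrib_centred (hid : ∀ k i, IdentDistrib (Z k i) (Z k 0) P P) (q : Fin 2 × Fin 2)
    (i : ℕ) : IdentDistrib (centred P Z q i) (centred P Z q 0) P P :=
  (hid q.1 i).comp (u := fun x : Plane => x q.2 - drift P Z q.1 q.2) (by fun_prop)

variable [IsProbabilityMeasure P]

lemma memLp_centred (hL : ∀ k i, MemLp (Z k i) 2 P) (q : Fin 2 × Fin 2) (i : ℕ) :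
    MemLp (centred P Z q i) 2 P := by
  refine MemLp.sub ?_ (memLp_const _)
  exact (hL q.1 i).continuousLinearMap_comp (EuclideanSpace.proj q.2 : Plane →L[ℝ] ℝ)

lemma integral_centred (hL : ∀ k i, MemLp (Z k i) 2 P) (q : Fin 2 × Fin 2) :
    ∫ ω, centred P Z q 0 ω ∂P = 0 := by
  have hint := (hL q.1 0).integrable (by norm_num)
  have h : ∫ ω, Z q.1 0 ω q.2 ∂P = (∫ ω, Z q.1 0 ω ∂P) q.2 :=
    (EuclideanSpace.proj q.2 : Plane →L[ℝ] ℝ).integral_comp_comm hint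
  unfold centred
  have hint' : Integrable (fun ω => Z q.1 0 ω q.2) P :=
    (EuclideanSpace.proj q.2 : Plane →L[ℝ] ℝ).integrable_comp hint
  rw [integral_sub hint' (integrable_const _)]
  simp [h, drift]

end Remainder

section Remainder

variable {Ω : Type*} [MeasurableSpace Ω] {P : Measure Ω} {Z : Fin 2 → ℕ → Ω → Plane}
  {A B : Option (Fin 2)} {γ : ℝ}

lemma sum_centred (k c : Fin 2) (j : ℕ) (ω : Ω) :
    ∑ i ∈ Finset.range j, centred P Z (k, c) i ω =
      (walk (Z k) j ω - (j : ℝ) • drift P Z k) c := by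
  simp [centred, walk, Finset.sum_sub_distrib]

lemma norm_sum_le_sum_of_abs_le {k : Fin 2} {x : Plane} {f : Fin 2 × Fin 2 → ℝ} (hf : ∀ q, 0 ≤ f q)
    (h : ∀ c, |x c| ≤ f (k, c)) : ‖x‖ ≤ ∑ q, f q := by
  refine (norm_le_sum_abs x).trans ((Finset.sum_le_sum fun c _ => h c).trans ?_)
  rw [Fintype.sum_prod_type]
  exact Finset.single_le_sum (f := fun k => ∑ c, f (k, c))
    (fun _ _ => Finset.sum_nonneg fun _ _ => hf _) (Finset.mem_univ k)

/-- The difference of the diameter and the projection of the difference of the end points. -/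
noncomputable def remainder (P : Measure Ω) (Z : Fin 2 → ℕ → Ω → Plane) (A B : Option (Fin 2))
    (n : ℕ) (ω : Ω) : ℝ :=
  diameter Z n ω - inner ℝ (endPoint (fun k j => walk (Z k) j ω) n A -
    endPoint (fun k j => walk (Z k) j ω) n B)
      (dir (vertex (drift P Z) A - vertex (drift P Z) B))

/-- The end points are themselves points of the walks, and projecting on a unit vector does not
increase length. -/
lemma remainder_nonneg (hv : vertex (drift P Z) A - vertex (drift P Z) B ≠ 0) (n : ℕ) (ω : Ω) :
    0 ≤ remainder P Z A B n ω := by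
  have h : ∀ T, ∃ k, ∃ j ≤ n, endPoint (fun k j => walk (Z k) j ω) n T = walk (Z k) j ω := by
    rintro (_ | k)
    · exact ⟨0, 0, n.zero_le, by simp [endPoint, walk]⟩
    · exact ⟨k, n, le_rfl, rfl⟩
  obtain ⟨a, i, hi, hA⟩ := h A
  obtain ⟨b, j, hj, hB⟩ := h B
  rw [remainder, sub_nonneg, hA, hB]
  exact (inner_dir_le_norm hv _).trans (norm_walk_sub_walk_le_diameter n ω hi hj)

/-- The bound of the remainder by running maxima, for one coordinate of one walk. -/
noncomputable def remainderBound (P : Measure Ω) (Z : Fin 2 → ℕ → Ω → Plane) (ε ρ : ℝ) (d n : ℕ)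
    (ω : Ω) (q : Fin 2 × Fin 2) : ℝ :=
  2 * maxExcess (fun i => centred P Z q i ω) 0 d +
    4 * maxExcess (fun i => centred P Z q (n - d + i) ω) 0 d +
    2 * ε * maxExcess (fun i => centred P Z q i ω) 0 n +
    8 * maxExcess (fun i => centred P Z q i ω) (ρ / 4 * n) n

lemma LongestSide.remainder_le (h : LongestSide (drift P Z) A B γ) (hγ : 0 < γ)
    (hv : vertex (drift P Z) A - vertex (drift P Z) B ≠ 0) {ε : ℝ} (hε : 0 < ε) :
    ∃ δ > 0, δ ≤ 1 ∧ δ ≤ ε ^ 2 ∧ ∃ ρ > 0, ∀ n : ℕ, 0 < n → ∀ ω,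
      remainder P Z A B n ω ≤ ∑ q, remainderBound P Z ε ρ ⌊δ * n⌋₊ n ω q := by
  obtain ⟨r, hr0, hr⟩ := norm_sub_norm_le_inner_dir_add hv hε
  set K := ‖drift P Z 0‖ + ‖drift P Z 1‖ with hKdef
  have hK : ∀ k, ‖drift P Z k‖ ≤ K := by
    intro k; fin_cases k <;> simp [hKdef]
  have hK0 : 0 ≤ K := by positivity
  -- The bound `ε ^ 2` makes the window fluctuations comparable with `ε ^ 2 * n` in mean square; the
  -- last term keeps the means near the ends within the range of the linearisation.
  set δ := min (min 1 (ε ^ 2)) (r / (4 * (K + 1))) with hδdef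
  have hδ0 : 0 < δ := by positivity
  have hδ1 : δ ≤ 1 := (min_le_left _ _).trans (min_le_left _ _)
  have hδK : 4 * (δ * K) ≤ r := by
    have : δ ≤ r / (4 * (K + 1)) := min_le_right _ _
    rw [le_div_iff₀ (by positivity)] at this
    nlinarith
  refine ⟨δ, hδ0, hδ1, (min_le_left _ _).trans (min_le_right _ _),
    min (r / 8) (γ * δ / 8), by positivity, fun n hn ω => ?_⟩
  set ρ := min (r / 8) (γ * δ / 8) with hρdef
  have hρr : ρ ≤ r / 8 := min_le_left _ _
  have hργ : ρ ≤ γ * δ / 8 := min_le_right _ _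
  have hn0 : (0 : ℝ) < n := by exact_mod_cast hn
  set d := ⌊δ * n⌋₊ with hd
  have hdn : d ≤ n := by
    refine Nat.floor_le_of_le ?_
    nlinarith
  set M := ∑ q, maxExcess (fun i => centred P Z q i ω) 0 n with hM
  set I := ∑ q, (maxExcess (fun i => centred P Z q i ω) 0 d +
    2 * maxExcess (fun i => centred P Z q (n - d + i) ω) 0 d) with hI
  -- `M` is a sum over four pairs of a walk and a coordinate, so the level `ρ * n` is split into
  -- four equal parts.
  have hex : excess (ρ * n) M ≤ ∑ q, maxExcess (fun i => centred P Z q i ω) (ρ / 4 * n) n := by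
    refine max_le ?_ (Finset.sum_nonneg fun _ _ => maxExcess_nonneg _ _ _)
    rw [abs_of_nonneg (Finset.sum_nonneg fun _ _ => maxExcess_nonneg _ _ _)]
    have := Finset.sum_le_sum fun q (_ : q ∈ Finset.univ) =>
      maxExcess_zero_sub_le (fun i => centred P Z q i ω) (ρ / 4 * n) n
    rw [Finset.sum_sub_distrib] at this
    simp only [Finset.sum_const, Finset.card_univ, Fintype.card_prod, Fintype.card_fin,
      nsmul_eq_mul] at this
    push_cast at this
    linarith
  have hsum : ∑ q, remainderBound P Z ε ρ d n ω q = 2 * I + 2 * ε * M +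
      8 * ∑ q, maxExcess (fun i => centred P Z q i ω) (ρ / 4 * n) n := by
    simp only [remainderBound, hM, hI, Finset.sum_add_distrib, Finset.mul_sum, mul_add]
    congr 3
    exact Finset.sum_congr rfl fun _ _ => by ring
  rw [hsum, remainder, sub_le_iff_le_add]
  refine diameter_le fun a b i hi j hj => ?_
  have := h.norm_sub_le_inner_add (S := fun k j => walk (Z k) j ω) (M := M) (I := I) (ρ := ρ)
    hγ.le hv hε.le hr hn hK hδ0.le hδ1 hδK (by linarith) (by linarith)
    (fun k j hj => norm_sum_le_sum_of_abs_le (k := k) (fun q => maxExcess_nonneg _ _ _) fun c => by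
      rw [← sum_centred]
      exact abs_sum_le_maxExcess (fun i => centred P Z (k, c) i ω) hj)
    (fun k j hj hjd => norm_sum_le_sum_of_abs_le (k := k) (fun q => by
        linarith [maxExcess_nonneg (fun i => centred P Z q i ω) 0 d,
          maxExcess_nonneg (fun i => centred P Z q (n - d + i) ω) 0 d]) fun c => by
      rw [← sum_centred]
      have h1 := abs_sum_le_maxExcess (fun i => centred P Z (k, c) i ω) (n := d)
        (Nat.le_floor hjd)
      linarith [maxExcess_nonneg (fun i => centred P Z (k, c) (n - d + i) ω) 0 d])
    (fun k j hj hjd => norm_sum_le_sum_of_abs_le (k := k) (fun q => by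
        linarith [maxExcess_nonneg (fun i => centred P Z q i ω) 0 d,
          maxExcess_nonneg (fun i => centred P Z q (n - d + i) ω) 0 d]) fun c => by
      rw [PiLp.sub_apply, ← sum_centred, ← sum_centred]
      have hjd' : n - d ≤ j := by
        have : n - j ≤ d := by
          refine Nat.le_floor ?_
          rw [Nat.cast_sub hj]; linarith
        omega
      have h1 := abs_sum_sub_sum_le_maxExcess (fun i => centred P Z (k, c) i ω) hj hjd' hdn
      linarith [maxExcess_nonneg (fun i => centred P Z (k, c) i ω) 0 d])
    (a := a) (b := b) hi hj
  linarith

lemma sq_remainderBound_le (ε ρ : ℝ) (d n : ℕ) (ω : Ω) (q : Fin 2 × Fin 2) :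
    remainderBound P Z ε ρ d n ω q ^ 2 ≤
      16 * maxExcess (fun i => centred P Z q (0 + i) ω) 0 d ^ 2 +
      64 * maxExcess (fun i => centred P Z q (n - d + i) ω) 0 d ^ 2 +
      16 * ε ^ 2 * maxExcess (fun i => centred P Z q (0 + i) ω) 0 n ^ 2 +
      256 * maxExcess (fun i => centred P Z q i ω) (ρ / 4 * n) n ^ 2 := by
  simp only [zero_add, remainderBound]
  have key : ∀ w x y z : ℝ, (w + x + y + z) ^ 2 ≤ 4 * (w ^ 2 + x ^ 2 + y ^ 2 + z ^ 2) := by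
    intro w x y z
    nlinarith [sq_nonneg (w - x), sq_nonneg (w - y), sq_nonneg (w - z), sq_nonneg (x - y),
      sq_nonneg (x - z), sq_nonneg (y - z)]
  refine (key _ _ _ _).trans (le_of_eq ?_)
  ring

variable [IsProbabilityMeasure P]

lemma memLp_remainderBound (hL : ∀ k i, MemLp (Z k i) 2 P) {ρ : ℝ} (hρ : 0 ≤ ρ) (ε : ℝ) (d n : ℕ)
    (q : Fin 2 × Fin 2) : MemLp (fun ω => remainderBound P Z ε ρ d n ω q) 2 P :=
  ((((memLp_maxExcess (memLp_centred hL q) le_rfl d).const_mul 2).add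
    ((memLp_maxExcess (fun i => memLp_centred hL q (n - d + i)) le_rfl d).const_mul 4)).add
    ((memLp_maxExcess (memLp_centred hL q) le_rfl n).const_mul (2 * ε))).add
    ((memLp_maxExcess (memLp_centred hL q) (by positivity) n).const_mul 8)

/-- Doob's factor `4` turns the first three terms into `(64 + 256) d + 64 ε² n` times the variance;
with `d ≤ ε² n` this is `384 ε² n`, rounded up to `400 ε² n`. -/
lemma integral_sq_remainderBound_le (hm : ∀ k i, Measurable (Z k i))
    (hind : iIndepFun (fun p : Fin 2 × ℕ => Z p.1 p.2) P)
    (hid : ∀ k i, IdentDistrib (Z k i) (Z k 0) P P) (hL : ∀ k i, MemLp (Z k i) 2 P)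
    {ρ ε δ : ℝ} (hρ : 0 ≤ ρ) (hδ : 0 ≤ δ) (hδε : δ ≤ ε ^ 2) (n : ℕ) (q : Fin 2 × Fin 2) :
    ∫ ω, remainderBound P Z ε ρ ⌊δ * n⌋₊ n ω q ^ 2 ∂P ≤ 400 * ε ^ 2 * Var[centred P Z q 0; P] * n +
      256 * ∫ ω, maxExcess (fun i => centred P Z q i ω) (ρ / 4 * n) n ^ 2 ∂P := by
  set d := ⌊δ * n⌋₊ with hd
  have hdn : (d : ℝ) ≤ ε ^ 2 * n :=
    (Nat.floor_le (by positivity)).trans (mul_le_mul_of_nonneg_right hδε (Nat.cast_nonneg n))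
  have i1 := ((memLp_maxExcess (fun i => memLp_centred hL q (0 + i)) le_rfl d).integrable_sq).const_mul
    16
  have i2 := ((memLp_maxExcess (fun i => memLp_centred hL q (n - d + i)) le_rfl
    d).integrable_sq).const_mul 64
  have i3 := ((memLp_maxExcess (fun i => memLp_centred hL q (0 + i)) le_rfl
    n).integrable_sq).const_mul (16 * ε ^ 2)
  have i4 := ((memLp_maxExcess (memLp_centred hL q) (show 0 ≤ ρ / 4 * n by positivity)
    n).integrable_sq).const_mul 256
  have hbd := integral_maxExcess_shift_sq_le (measurable_centred hm q)
    (iIndepFun_centred (P := P) hind q) (identDistrib_centred hid q) (memLp_centred hL q 0)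
    (integral_centred hL q)
  have hvar := variance_nonneg (centred P Z q 0) P
  have hdv := mul_le_mul_of_nonneg_right hdn hvar
  calc _ ≤ _ := integral_mono ((memLp_remainderBound hL hρ ε d n q).integrable_sq)
        (((i1.fun_add i2).fun_add i3).fun_add i4) fun ω => sq_remainderBound_le ε ρ d n ω q
    _ = _ := by
      rw [integral_add ((i1.fun_add i2).fun_add i3) i4, integral_add (i1.fun_add i2) i3,
        integral_add i1 i2,
        integral_const_mul, integral_const_mul, integral_const_mul, integral_const_mul]
    _ ≤ _ := by
      have h3 := mul_le_mul_of_nonneg_left (hbd 0 n) (show 0 ≤ 16 * ε ^ 2 by positivity)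
      nlinarith [hbd 0 d, hbd (n - d) d, mul_nonneg (mul_nonneg (sq_nonneg ε) hvar)
        (Nat.cast_nonneg (α := ℝ) n)]

/-- The diameter is well approximated in `L²` by the projected difference of the end points. -/
theorem LongestSide.tendsto_integral_remainder_sq_div (h : LongestSide (drift P Z) A B γ)
    (hγ : 0 < γ) (hv : vertex (drift P Z) A - vertex (drift P Z) B ≠ 0)
    (hm : ∀ k i, Measurable (Z k i)) (hind : iIndepFun (fun p : Fin 2 × ℕ => Z p.1 p.2) P)
    (hid : ∀ k i, IdentDistrib (Z k i) (Z k 0) P P) (hL : ∀ k i, MemLp (Z k i) 2 P) :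
    Tendsto (fun n : ℕ => (∫ ω, remainder P Z A B n ω ^ 2 ∂P) / n) atTop (𝓝 0) := by
  set V := ∑ q, Var[centred P Z q 0; P] with hV
  have hV0 : 0 ≤ V := Finset.sum_nonneg fun q _ => variance_nonneg _ _
  rw [Metric.tendsto_atTop']
  intro η hη
  -- Chosen so that the main term `1600 ε² V` stays below `η / 2`. Here `1600 = 4 * 400`, the `4`
  -- coming from Cauchy–Schwarz over the four pairs; likewise `1024 = 4 * 256` below.
  set ε := √(η / (2 * (1600 * V + 1))) with hεdef
  have hε : 0 < ε := by positivity
  have hε2 : ε ^ 2 * (1600 * V) < η / 2 := by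
    rw [hεdef, Real.sq_sqrt (by positivity), div_mul_eq_mul_div, div_lt_iff₀ (by positivity)]
    nlinarith
  obtain ⟨δ, hδ0, -, hδε, ρ, hρ, hR⟩ := h.remainder_le hγ hv hε
  have hsmall : Tendsto (fun n : ℕ => ∑ q, 1024 *
      ((∫ ω, maxExcess (fun i => centred P Z q i ω) (ρ / 4 * n) n ^ 2 ∂P) / n)) atTop
      (𝓝 (∑ _q : Fin 2 × Fin 2, 1024 * 0)) :=
    tendsto_finsetSum _ fun q _ => (tendsto_integral_maxExcess_sq_div (measurable_centred hm q)
      (iIndepFun_centred (P := P) hind q) (identDistrib_centred hid q) (memLp_centred hL q 0)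
      (integral_centred hL q) (by positivity)).const_mul _
  simp only [mul_zero, Finset.sum_const_zero] at hsmall
  obtain ⟨N, hN⟩ := ((hsmall.eventually_lt_const (half_pos hη)).and
    (eventually_gt_atTop 0)).exists_forall_of_atTop
  refine ⟨N, fun n hn => ?_⟩
  obtain ⟨h1, h2⟩ := hN n hn.le
  have hn0 : (0 : ℝ) < n := by exact_mod_cast h2
  rw [dist_zero_right, Real.norm_eq_abs, abs_of_nonneg (by positivity)]
  have hint : ∀ q, Integrable (fun ω => 4 * remainderBound P Z ε ρ ⌊δ * n⌋₊ n ω q ^ 2) P :=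
    fun q => (memLp_remainderBound hL hρ.le ε _ n q).integrable_sq.const_mul 4
  have hle : ∫ ω, remainder P Z A B n ω ^ 2 ∂P ≤
      ∑ q, 4 * ∫ ω, remainderBound P Z ε ρ ⌊δ * n⌋₊ n ω q ^ 2 ∂P := by
    simp only [← integral_const_mul]
    rw [← integral_finsetSum _ fun q _ => hint q]
    refine integral_mono_of_nonneg (ae_of_all _ fun ω => sq_nonneg _)
      (integrable_finsetSum _ fun q _ => hint q) (ae_of_all _ fun ω => ?_)
    have hsq := pow_le_pow_left₀ (remainder_nonneg hv n ω) (hR n h2 ω) 2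
    refine hsq.trans ((sq_sum_le_card_mul_sum_sq).trans (le_of_eq ?_))
    simp [Finset.mul_sum]
  rw [div_lt_iff₀ hn0]
  have hle2 : ∑ q, 4 * ∫ ω, remainderBound P Z ε ρ ⌊δ * n⌋₊ n ω q ^ 2 ∂P ≤
      ε ^ 2 * (1600 * V) * n + (∑ q, 1024 *
      ((∫ ω, maxExcess (fun i => centred P Z q i ω) (ρ / 4 * n) n ^ 2 ∂P) / n)) * n := by
    rw [hV, Finset.mul_sum, Finset.mul_sum, Finset.sum_mul, Finset.sum_mul,
      ← Finset.sum_add_distrib]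
    refine Finset.sum_le_sum fun q _ => ?_
    have := integral_sq_remainderBound_le hm hind hid hL hρ.le hδ0.le hδε n q
    rw [mul_assoc 1024, div_mul_cancel₀ _ hn0.ne']
    linarith
  have := mul_lt_mul_of_pos_right (add_lt_add hε2 h1) hn0
  linarith

end Remainder

/-! ### Transfer of variance asymptotics and of the central limit theorem -/

section Limit

variable {Ω : Type*} [MeasurableSpace Ω] {P : Measure Ω} [IsProbabilityMeasure P]

/-- The quadratic `t ↦ Var[t X + Y]` is nonnegative, so its discriminant is not positive. -/
lemma covariance_sq_le {X Y : Ω → ℝ} (hX : MemLp X 2 P) (hY : MemLp Y 2 P) :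
    cov[X, Y; P] ^ 2 ≤ Var[X; P] * Var[Y; P] := by
  have h : ∀ t : ℝ, 0 ≤ Var[X; P] * (t * t) + 2 * cov[X, Y; P] * t + Var[Y; P] := fun t => by
    have := variance_nonneg (fun ω => t * X ω + Y ω) P
    rw [variance_fun_add (hX.const_mul t) hY, variance_const_mul, covariance_const_mul_left] at this
    linarith
  have := discrim_le_zero h
  rw [discrim] at this
  linarith

variable {D X : ℕ → Ω → ℝ}

lemma tendsto_variance_remainder_div (hD : ∀ n, MemLp (D n) 2 P) (hX : MemLp (X 0) 2 P)
    (hid : ∀ i, IdentDistrib (X i) (X 0) P P)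
    (hR : Tendsto (fun n : ℕ => (∫ ω, (D n ω - ∑ i ∈ Finset.range n, X i ω) ^ 2 ∂P) / n) atTop
      (𝓝 0)) :
    Tendsto (fun n : ℕ => Var[fun ω => D n ω - ∑ i ∈ Finset.range n, X i ω; P] / n) atTop
      (𝓝 0) := by
  refine squeeze_zero (fun n => div_nonneg (variance_nonneg _ _) (Nat.cast_nonneg n))
    (fun n => ?_) hR
  refine div_le_div_of_nonneg_right ?_ (Nat.cast_nonneg n)
  exact variance_le_expectation_sq
    ((hD n).sub (memLp_finsetSum _ fun i _ => (hid i).memLp_iff.2 hX)).1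

/-- Expand the variance of sum plus remainder; by Cauchy–Schwarz the covariance is at most `√(n
Var[X 0] · o(n)) = o(n)`. -/
lemma tendsto_variance_div (hD : ∀ n, MemLp (D n) 2 P) (hX : MemLp (X 0) 2 P)
    (hind : iIndepFun X P) (hid : ∀ i, IdentDistrib (X i) (X 0) P P)
    (hR : Tendsto (fun n : ℕ => (∫ ω, (D n ω - ∑ i ∈ Finset.range n, X i ω) ^ 2 ∂P) / n) atTop
      (𝓝 0)) :
    Tendsto (fun n : ℕ => Var[D n; P] / n) atTop (𝓝 Var[X 0; P]) := by
  have hSL : ∀ n : ℕ, MemLp (fun ω => ∑ i ∈ Finset.range n, X i ω) 2 P := fun n =>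
    memLp_finsetSum _ fun i _ => (hid i).memLp_iff.2 hX
  have hV := tendsto_variance_remainder_div hD hX hid hR
  set R : ℕ → Ω → ℝ := fun n ω => D n ω - ∑ i ∈ Finset.range n, X i ω with hRdef
  have hRL : ∀ n, MemLp (R n) 2 P := fun n => (hD n).sub (hSL n)
  have hcov : Tendsto (fun n : ℕ => cov[fun ω => ∑ i ∈ Finset.range n, X i ω, R n; P] / n) atTop
      (𝓝 0) := by
    refine squeeze_zero_norm' (a := fun n : ℕ => √(Var[X 0; P] * (Var[R n; P] / n))) ?_ ?_
    · filter_upwards [eventually_gt_atTop 0] with n hn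
      have hn0 : (0 : ℝ) < n := by exact_mod_cast hn
      refine Real.abs_le_sqrt ?_
      rw [div_pow, div_le_iff₀ (by positivity)]
      refine (covariance_sq_le (hSL n) (hRL n)).trans (le_of_eq ?_)
      rw [variance_sum_eq hX hind hid]
      field_simp
    · have := (hV.const_mul Var[X 0; P]).sqrt
      simpa using this
  have hlim : Tendsto (fun n : ℕ => Var[X 0; P] +
      2 * (cov[fun ω => ∑ i ∈ Finset.range n, X i ω, R n; P] / n) + Var[R n; P] / n) atTop
      (𝓝 (Var[X 0; P] + 2 * 0 + 0)) := (tendsto_const_nhds.add (hcov.const_mul 2)).add hV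
  simp only [mul_zero, add_zero] at hlim
  refine hlim.congr' ?_
  filter_upwards [eventually_gt_atTop 0] with n hn
  have hn0 : (0 : ℝ) < n := by exact_mod_cast hn
  have e : D n = fun ω => ∑ i ∈ Finset.range n, X i ω + R n ω := by ext ω; simp [hRdef]
  have h := variance_fun_add (hSL n) (hRL n)
  rw [← e, variance_sum_eq hX hind hid] at h
  rw [h]
  field_simp

lemma tendsto_measureReal_le_of_tendstoInDistribution {Y : ℕ → Ω → ℝ} {ν : Measure ℝ}
    [IsProbabilityMeasure ν] [NullSingletonClass ν] {Ω' : Type*} [MeasurableSpace Ω']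
    {P' : Measure Ω'} [IsProbabilityMeasure P'] {G : Ω' → ℝ}
    (h : TendstoInDistribution Y atTop G (fun _ => P) P') (hG : HasLaw G ν P') (x : ℝ) :
    Tendsto (fun n => P.real {ω | Y n ω ≤ x}) atTop (𝓝 (cdf ν x)) := by
  have key := ProbabilityMeasure.tendsto_measure_of_null_frontier_of_tendsto' h.tendsto
    (E := Set.Iic x) (by
      rw [ProbabilityMeasure.coe_mk, hG.map_eq, frontier_Iic, measure_singleton])
  have := (ENNReal.tendsto_toReal (by
    rw [ProbabilityMeasure.coe_mk, hG.map_eq]; exact measure_ne_top _ _)).comp key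
  simp only [ProbabilityMeasure.coe_mk, hG.map_eq] at this
  rw [cdf_eq_real]
  refine this.congr fun n => ?_
  simp only [Function.comp]
  rw [Measure.map_apply_of_aemeasurable (h.forall_aemeasurable n) measurableSet_Iic]
  rfl

/-- A central limit theorem for variables that are close in `L²` to sums of i.i.d. variables. -/
theorem tendsto_measureReal_div_le (hD : ∀ n, MemLp (D n) 2 P) (hX : MemLp (X 0) 2 P)
    (hind : iIndepFun X P) (hid : ∀ i, IdentDistrib (X i) (X 0) P P) (hσ : 0 < Var[X 0; P])
    (hR : Tendsto (fun n : ℕ => (∫ ω, (D n ω - ∑ i ∈ Finset.range n, X i ω) ^ 2 ∂P) / n) atTop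
      (𝓝 0)) {s : ℕ → ℝ} (hs : Tendsto (fun n : ℕ => √n / s n) atTop (𝓝 (√Var[X 0; P])⁻¹))
    (x : ℝ) :
    Tendsto (fun n : ℕ => P.real {ω | (D n ω - ∫ ω', D n ω' ∂P) / s n ≤ x}) atTop
      (𝓝 (cdf (gaussianReal 0 1) x)) := by
  have hSL : ∀ n : ℕ, MemLp (fun ω => ∑ i ∈ Finset.range n, X i ω) 2 P := fun n =>
    memLp_finsetSum _ fun i _ => (hid i).memLp_iff.2 hX
  have hV := tendsto_variance_remainder_div hD hX hid hR
  set R : ℕ → Ω → ℝ := fun n ω => D n ω - ∑ i ∈ Finset.range n, X i ω with hRdef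
  have hRL : ∀ n, MemLp (R n) 2 P := fun n => (hD n).sub (hSL n)
  set v : NNReal := Var[X 0; P].toNNReal with hv
  have hvv : (v : ℝ) = Var[X 0; P] := Real.coe_toNNReal _ (variance_nonneg _ _)
  have hclt := tendstoInDistribution_inv_sqrt_mul_sum_sub (P' := gaussianReal 0 v) (Y := id)
    HasLaw.id hX hind hid
  have hmean : ∀ n, ∫ ω, R n ω ∂P = ∫ ω, D n ω ∂P - n * ∫ ω, X 0 ω ∂P := fun n => by
    rw [integral_sub ((hD n).integrable (by norm_num)) ((hSL n).integrable (by norm_num)),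
      integral_finsetSum _ fun i _ => ((hid i).memLp_iff.2 hX).integrable (by norm_num),
      Finset.sum_congr rfl fun i _ => (hid i).integral_eq]
    simp
  have hD' : TendstoInDistribution (fun (n : ℕ) ω => (√(n : ℝ))⁻¹ * (D n ω - ∫ ω', D n ω' ∂P)) atTop
      id (fun _ => P) (gaussianReal 0 v) := by
    -- With both sides centred at their own means, the difference is the centred remainder over
    -- `√n`, and Chebyshev needs only its variance to be `o(n)`.
    refine tendstoInDistribution_of_tendstoInMeasure_sub _ _ hclt ?_ fun n =>
      ((hD n).1.aemeasurable.sub_const _).const_mul _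
    rw [tendstoInMeasure_iff_norm]
    intro ε hε
    have hz : Tendsto (fun n : ℕ => ENNReal.ofReal (Var[R n; P] / n / ε ^ 2)) atTop (𝓝 0) := by
      simpa using ENNReal.tendsto_ofReal (hV.div_const (ε ^ 2))
    refine tendsto_of_tendsto_of_tendsto_of_le_of_le' tendsto_const_nhds hz
      (Eventually.of_forall fun _ => zero_le) ?_
    filter_upwards [eventually_gt_atTop 0] with n hn
    have hn0 : (0 : ℝ) < n := by exact_mod_cast hn
    have hsq : 0 < √(n : ℝ) := Real.sqrt_pos.2 hn0
    have := meas_ge_le_variance_div_sq (hRL n) (mul_pos hε hsq)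
    rw [mul_pow, Real.sq_sqrt hn0.le, mul_comm (ε ^ 2), ← div_div] at this
    refine (measure_mono fun ω hω => ?_).trans this
    change ε ≤ ‖(√(n : ℝ))⁻¹ * (D n ω - ∫ ω', D n ω' ∂P) -
      (√(n : ℝ))⁻¹ * (∑ i ∈ Finset.range n, X i ω - n * ∫ ω', X 0 ω' ∂P) - 0‖ at hω
    change ε * √(n : ℝ) ≤ |R n ω - ∫ ω', R n ω' ∂P|
    rw [sub_zero, ← mul_sub] at hω
    rw [norm_mul, norm_inv, Real.norm_of_nonneg hsq.le, le_inv_mul_iff₀ hsq, Real.norm_eq_abs] at hω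
    rw [mul_comm, hmean]
    refine hω.trans_eq (congrArg abs ?_)
    change _ = D n ω - ∑ i ∈ Finset.range n, X i ω - _
    ring
  -- Slutsky: the deterministic factor `√n / s n` replaces the normalisation `√n` by `s n`.
  have hprod := hD'.continuous_comp_prodMk_of_tendstoInMeasure_const
    (g := fun p : ℝ × ℝ => p.1 * p.2) (by fun_prop)
    (Y := fun (n : ℕ) _ => √(n : ℝ) / s n) (c := (√Var[X 0; P])⁻¹)
    (tendstoInMeasure_of_tendsto_ae (fun _ => aestronglyMeasurable_const)
      (ae_of_all _ fun _ => hs)) (fun _ => aemeasurable_const)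
  have hlaw : HasLaw (fun y : ℝ => id y * (√Var[X 0; P])⁻¹) (gaussianReal 0 1)
      (gaussianReal 0 v) := by
    convert gaussianReal_mul_const (HasLaw.id (μ := gaussianReal 0 v)) (√Var[X 0; P])⁻¹ using 2
    · simp
    · ext
      simp only [NNReal.coe_mul, NNReal.coe_mk, NNReal.coe_one]
      rw [hvv, inv_pow, Real.sq_sqrt hσ.le, inv_mul_cancel₀ hσ.ne']
  have := nullSingletonClass_gaussianReal (μ := 0) (v := 1) one_ne_zero
  refine (tendsto_measureReal_le_of_tendstoInDistribution hprod hlaw x).congr' ?_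
  filter_upwards [eventually_gt_atTop 0] with n hn
  have hsq : √(n : ℝ) ≠ 0 := (Real.sqrt_pos.2 (by exact_mod_cast hn)).ne'
  congr 1
  ext ω
  simp only [Set.mem_ofPred_eq]
  field_simp

theorem tendsto_sqrt_div_sqrt_variance (hD : ∀ n, MemLp (D n) 2 P) (hX : MemLp (X 0) 2 P)
    (hind : iIndepFun X P) (hid : ∀ i, IdentDistrib (X i) (X 0) P P) (hσ : 0 < Var[X 0; P])
    (hR : Tendsto (fun n : ℕ => (∫ ω, (D n ω - ∑ i ∈ Finset.range n, X i ω) ^ 2 ∂P) / n) atTop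
      (𝓝 0)) :
    Tendsto (fun n : ℕ => √n / √Var[D n; P]) atTop (𝓝 (√Var[X 0; P])⁻¹) := by
  have := ((tendsto_variance_div hD hX hind hid hR).sqrt).inv₀ (Real.sqrt_pos.2 hσ).ne'
  refine this.congr fun n => ?_
  rw [Real.sqrt_div (variance_nonneg _ _), inv_div]

end Limit

/-! ### Projected steps, choice of the longest side, and conclusion -/

lemma exists_longestSide_of_lt {m : Fin 2 → Plane} {A B : Option (Fin 2)} (hAB : A ≠ B)
    (h : ∀ C D, (C, D) ≠ (A, B) → (C, D) ≠ (B, A) →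
      ‖vertex m C - vertex m D‖ < ‖vertex m A - vertex m B‖) :
    ∃ γ > 0, LongestSide m A B γ := by
  classical
  let s : Finset (Option (Fin 2) × Option (Fin 2)) := {p | p ≠ (A, B) ∧ p ≠ (B, A)}
  have hs : s.Nonempty := ⟨(A, A), by simp [s, hAB]⟩
  let f : Option (Fin 2) × Option (Fin 2) → ℝ := fun p =>
    ‖vertex m A - vertex m B‖ - ‖vertex m p.1 - vertex m p.2‖
  refine ⟨s.inf' hs f, ?_, fun C D h1 h2 => ?_⟩
  · rw [gt_iff_lt, Finset.lt_inf'_iff]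
    rintro ⟨C, D⟩ hp
    simp only [s, Finset.mem_filter, Finset.mem_univ, true_and] at hp
    exact sub_pos.2 (h C D hp.1 hp.2)
  · have : s.inf' hs f ≤ f (C, D) := Finset.inf'_le f
      (Finset.mem_filter.2 ⟨Finset.mem_univ _, h1, h2⟩)
    simp only [f] at this
    linarith

section Steps

variable {Ω : Type*} [MeasurableSpace Ω] {P : Measure Ω}
  {Z : Fin 2 → ℕ → Ω → Plane}

/-- The joint law matters because a projected step may involve both walks; independence of the walks
makes it the product of the marginals. -/
lemma identDistrib_pair (hind : iIndepFun (fun p : Fin 2 × ℕ => Z p.1 p.2) P)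
    (hid : ∀ k i, IdentDistrib (Z k i) (Z k 0) P P) (i : ℕ) :
    IdentDistrib (fun ω k => Z k i ω) (fun ω k => Z k 0 ω) P P :=
  IdentDistrib.pi (fun k => hid k i)
    (hind.precomp (g := fun k : Fin 2 => (k, i)) fun _ _ h => (Prod.mk.inj h).1)
    (hind.precomp (g := fun k : Fin 2 => (k, 0)) fun _ _ h => (Prod.mk.inj h).1)

/-- The steps of the difference of the two labelled walks, projected on the direction of its
drift. -/
noncomputable def projectedStep (P : Measure Ω) (Z : Fin 2 → ℕ → Ω → Plane)
    (A B : Option (Fin 2)) (i : ℕ) (ω : Ω) : ℝ :=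
  inner ℝ (vertex (fun k => Z k i ω) A - vertex (fun k => Z k i ω) B)
    (dir (vertex (drift P Z) A - vertex (drift P Z) B))

lemma measurable_vertex (T : Option (Fin 2)) : Measurable fun z : Fin 2 → Plane => vertex z T := by
  cases T with
  | none => exact measurable_const
  | some k => exact measurable_pi_apply k

lemma memLp_vertex (hL : ∀ k i, MemLp (Z k i) 2 P) (T : Option (Fin 2)) (i : ℕ) :
    MemLp (fun ω => vertex (fun k => Z k i ω) T) 2 P := by
  cases T with
  | none => exact MemLp.zero
  | some k => exact hL k i

lemma integral_vertex (T : Option (Fin 2)) :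
    ∫ ω, vertex (fun k => Z k 0 ω) T ∂P = vertex (drift P Z) T := by
  cases T with
  | none => simp [vertex]
  | some k => rfl

lemma sum_projectedStep (A B : Option (Fin 2)) (n : ℕ) (ω : Ω) :
    ∑ i ∈ Finset.range n, projectedStep P Z A B i ω =
      inner ℝ (endPoint (fun k j => walk (Z k) j ω) n A - endPoint (fun k j => walk (Z k) j ω) n B)
        (dir (vertex (drift P Z) A - vertex (drift P Z) B)) := by
  have h : ∀ T, endPoint (fun k j => walk (Z k) j ω) n T =
      ∑ i ∈ Finset.range n, vertex (fun k => Z k i ω) T := by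
    rintro (_ | k)
    · simp [endPoint, vertex]
    · rfl
  rw [h, h, ← Finset.sum_sub_distrib, sum_inner]
  rfl

variable [IsProbabilityMeasure P]

/-- Independence is grouped by time: currying turns the product law over `ℕ × Fin 2` into a product
over `ℕ` of the laws of the pairs. -/
lemma iIndepFun_pair (hm : ∀ k i, Measurable (Z k i))
    (hind : iIndepFun (fun p : Fin 2 × ℕ => Z p.1 p.2) P) :
    iIndepFun (fun (i : ℕ) ω k => Z k i ω) P := by
  have h1 : iIndepFun (fun (p : ℕ × Fin 2) => Z p.2 p.1) P := hind.precomp Prod.swap_injective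
  have h2 : ∀ i, iIndepFun (fun k => Z k i) P := fun i =>
    hind.precomp (g := fun k : Fin 2 => (k, i)) fun _ _ h => (Prod.mk.inj h).1
  have : ∀ i k, IsProbabilityMeasure (P.map (Z k i)) :=
    fun i k => Measure.isProbabilityMeasure_map (hm k i).aemeasurable
  rw [iIndepFun_iff_map_fun_eq_infinitePi_map (by fun_prop)]
  have e : (fun ω (i : ℕ) (k : Fin 2) => Z k i ω) =
      MeasurableEquiv.curry ℕ (Fin 2) Plane ∘ fun ω p => Z p.2 p.1 ω := rfl
  rw [e, ← Measure.map_map (by fun_prop) (by fun_prop),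
    (iIndepFun_iff_map_fun_eq_infinitePi_map (by fun_prop)).1 h1,
    Measure.infinitePi_map_curry (fun i k => P.map (Z k i))]
  congr 1
  ext1 i
  exact ((iIndepFun_iff_map_fun_eq_infinitePi_map (by fun_prop)).1 (h2 i)).symm

lemma variance_projectedStep (hL : ∀ k i, MemLp (Z k i) 2 P) (A B : Option (Fin 2)) :
    Var[projectedStep P Z A B 0; P] =
      ∫ ω, (inner ℝ (vertex (fun k => Z k 0 ω - drift P Z k) A -
        vertex (fun k => Z k 0 ω - drift P Z k) B)
          (dir (vertex (drift P Z) A - vertex (drift P Z) B))) ^ 2 ∂P := by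
  have hA := memLp_vertex hL A 0
  have hB := memLp_vertex hL B 0
  have hY : MemLp (projectedStep P Z A B 0) 2 P := (hA.sub hB).inner_const _
  have hmean : ∫ ω, projectedStep P Z A B 0 ω ∂P =
      inner ℝ (vertex (drift P Z) A - vertex (drift P Z) B)
        (dir (vertex (drift P Z) A - vertex (drift P Z) B)) := by
    simp only [projectedStep]
    simp_rw [real_inner_comm (dir _)]
    have hint : Integrable (fun ω => vertex (fun k => Z k 0 ω) A - vertex (fun k => Z k 0 ω) B) P :=
      (hA.sub hB).integrable (by norm_num)
    rw [integral_inner hint]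
    congr 1
    rw [← integral_vertex A, ← integral_vertex B]
    exact integral_sub (hA.integrable (by norm_num)) (hB.integrable (by norm_num))
  rw [variance_eq_integral hY.1.aemeasurable, hmean]
  congr 1
  ext ω
  rw [projectedStep, ← inner_sub_left]
  congr 2
  cases A <;> cases B <;> simp [vertex] <;> abel

theorem LongestSide.clt {A B : Option (Fin 2)} {γ : ℝ} (h : LongestSide (drift P Z) A B γ)
    (hγ : 0 < γ) (hAB : A ≠ B) (hm : ∀ k i, Measurable (Z k i))
    (hind : iIndepFun (fun p : Fin 2 × ℕ => Z p.1 p.2) P)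
    (hid : ∀ k i, IdentDistrib (Z k i) (Z k 0) P P) (hL : ∀ k i, MemLp (Z k i) 2 P)
    (hσ : Var[projectedStep P Z A B 0; P] = sigmaDSq P Z) (hσ0 : 0 < sigmaDSq P Z) (x : ℝ) :
    Tendsto (fun n : ℕ => P.real {ω | (diameter Z n ω - ∫ ω', diameter Z n ω' ∂P)
          / √(variance (diameter Z n) P) ≤ x}) atTop (𝓝 (cdf (gaussianReal 0 1) x)) ∧
      Tendsto (fun n : ℕ => P.real {ω | (diameter Z n ω - ∫ ω', diameter Z n ω' ∂P)
          / √(sigmaDSq P Z * (n : ℝ)) ≤ x}) atTop (𝓝 (cdf (gaussianReal 0 1) x)) := by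
  have hv : vertex (drift P Z) A - vertex (drift P Z) B ≠ 0 :=
    norm_pos_iff.1 (hγ.trans_le (h.le.resolve_right hAB))
  have hD := memLp_diameter hm hL
  have hX : MemLp (projectedStep P Z A B 0) 2 P :=
    ((memLp_vertex hL A 0).sub (memLp_vertex hL B 0)).inner_const _
  have mstep : Measurable fun z : Fin 2 → Plane => (inner ℝ (vertex z A - vertex z B)
      (dir (vertex (drift P Z) A - vertex (drift P Z) B)) : ℝ) :=
    ((measurable_vertex A).sub (measurable_vertex B)).inner_const
  have hXind : iIndepFun (projectedStep P Z A B) P :=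
    (iIndepFun_pair hm hind).comp (fun _ z => inner ℝ (vertex z A - vertex z B)
      (dir (vertex (drift P Z) A - vertex (drift P Z) B))) fun _ => mstep
  have hXid : ∀ i, IdentDistrib (projectedStep P Z A B i) (projectedStep P Z A B 0) P P :=
    fun i => (identDistrib_pair hind hid i).comp mstep
  have hR := h.tendsto_integral_remainder_sq_div hγ hv hm hind hid hL
  simp only [remainder, ← sum_projectedStep] at hR
  have hσ' : 0 < Var[projectedStep P Z A B 0; P] := hσ ▸ hσ0
  refine ⟨tendsto_measureReal_div_le hD hX hXind hXid hσ' hR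
    (tendsto_sqrt_div_sqrt_variance hD hX hXind hXid hσ' hR) x,
    tendsto_measureReal_div_le hD hX hXind hXid hσ' hR ?_ x⟩
  refine tendsto_const_nhds.congr' ?_
  filter_upwards [eventually_gt_atTop 0] with n hn
  have hsq : √(n : ℝ) ≠ 0 := (Real.sqrt_pos.2 (by exact_mod_cast hn)).ne'
  rw [hσ, Real.sqrt_mul hσ0.le]
  field_simp

/-- The longest side of the triangle, together with the matching expression for `sigmaDSq`. -/
lemma exists_longestSide (hL : ∀ k i, MemLp (Z k i) 2 P) (hA1 : NonzeroSides (drift P Z))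
    (hA2 : UniqueLongestSide (drift P Z)) :
    ∃ A B : Option (Fin 2), A ≠ B ∧ (∃ γ > 0, LongestSide (drift P Z) A B γ) ∧
      Var[projectedStep P Z A B 0; P] = sigmaDSq P Z := by
  simp only [variance_projectedStep hL]
  unfold sigmaDSq
  set m := drift P Z with hmdef
  simp only [NonzeroSides, Set.mem_insert_iff, Set.mem_singleton_iff, not_or] at hA1
  obtain ⟨n0, n1, n2⟩ := hA1
  have p0 : 0 < ‖m 0‖ := norm_pos_iff.2 (Ne.symm n0)
  have p1 : 0 < ‖m 1‖ := norm_pos_iff.2 (Ne.symm n1)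
  have p2 : 0 < ‖m 0 - m 1‖ := norm_pos_iff.2 (Ne.symm n2)
  obtain ⟨i, hi, hu⟩ := hA2
  -- A side as long as the maximal one would be maximal too, contradicting uniqueness.
  have hlt : ∀ j, j ≠ i → ‖side m j‖ < ‖side m i‖ := fun j hj => by
    refine lt_of_le_of_ne (hi j) fun he => hj (hu j fun l => ?_)
    rw [he]
    exact hi l
  have p3 : ‖m 1 - m 0‖ = ‖m 0 - m 1‖ := norm_sub_rev _ _
  fin_cases i
  · have h1 : ‖m 1‖ < ‖m 0‖ := hlt 1 (by decide)
    have h2 : ‖m 0 - m 1‖ < ‖m 0‖ := hlt 2 (by decide)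
    refine ⟨some 0, none, by simp, exists_longestSide_of_lt (by simp) ?_, ?_⟩
    · simp [Option.forall, Fin.forall_fin_two, vertex, p0, h1, h2, p3]
    · rw [if_pos ⟨h1, h2⟩]
      simp [vertex]
  · have h1 : ‖m 0‖ < ‖m 1‖ := hlt 0 (by decide)
    have h2 : ‖m 0 - m 1‖ < ‖m 1‖ := hlt 2 (by decide)
    refine ⟨some 1, none, by simp, exists_longestSide_of_lt (by simp) ?_, ?_⟩
    · simp [Option.forall, Fin.forall_fin_two, vertex, p1, h1, h2, p3]
    · rw [if_neg (fun h => lt_asymm h1 h.1), if_pos ⟨h1, h2⟩]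
      simp [vertex]
  · have h1 : ‖m 0‖ < ‖m 0 - m 1‖ := hlt 0 (by decide)
    have h2 : ‖m 1‖ < ‖m 0 - m 1‖ := hlt 1 (by decide)
    refine ⟨some 0, some 1, by simp, exists_longestSide_of_lt (by simp) ?_, ?_⟩
    · simp [Option.forall, Fin.forall_fin_two, vertex, p2, h1, h2]
    · rw [if_neg (fun h => lt_asymm h1 h.2), if_neg (fun h => lt_asymm h2 h.2)]
      simp [vertex]

end Steps

end TwoWalks

theorem mainTheorem2 {Ω : Type*} [MeasurableSpace Ω] (P : Measure Ω) [IsProbabilityMeasure P]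
    (Z : Fin 2 → ℕ → Ω → TwoWalks.Plane)
    (hmeas : ∀ k i, Measurable (Z k i))
    (hindep : iIndepFun (fun (p : Fin 2 × ℕ) => Z p.1 p.2) P)
    (hident : ∀ k i, IdentDistrib (Z k i) (Z k 0) P P)
    (hmom : ∀ k, MemLp (Z k 0) 2 P)
    (hA1 : TwoWalks.NonzeroSides (TwoWalks.drift P Z))
    (hA2 : TwoWalks.UniqueLongestSide (TwoWalks.drift P Z))
    (hσ : 0 < TwoWalks.sigmaDSq P Z) :
    (∀ n : ℕ, MemLp (TwoWalks.diameter Z n) 2 P) ∧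
    ∀ x : ℝ,
      Tendsto (fun n : ℕ => P.real {ω | (TwoWalks.diameter Z n ω - ∫ ω', TwoWalks.diameter Z n ω' ∂P)
          / √(variance (TwoWalks.diameter Z n) P) ≤ x})
        atTop (𝓝 (cdf (gaussianReal 0 1) x)) ∧
      Tendsto (fun n : ℕ => P.real {ω | (TwoWalks.diameter Z n ω - ∫ ω', TwoWalks.diameter Z n ω' ∂P)
          / √(TwoWalks.sigmaDSq P Z * (n : ℝ)) ≤ x})
        atTop (𝓝 (cdf (gaussianReal 0 1) x)) := by
  have hL : ∀ k i, MemLp (Z k i) 2 P := fun k i => (hident k i).memLp_iff.2 (hmom k)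
  obtain ⟨A, B, hAB, ⟨γ, hγ, h⟩, hvar⟩ := TwoWalks.exists_longestSide hL hA1 hA2
  exact ⟨TwoWalks.memLp_diameter hmeas hL, h.clt hγ hAB hmeas hindep hident hL hvar hσ⟩
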